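/- **Theorem (product-formula simulation of $k$-local Hamiltonians).** Fix an integer $k\ge 1$. Let $H=\sum_{j_1,\dots,j_k=1}^{n}H_{j_1,\dots,j_k}$ be a $k$-local Hamiltonian on $n$ qubits, where each $H_{j_1,\dots,j_k}$ is Hermitian and acts nontrivially only on the qubits $j_1,\dots,j_k$. Let $\|\cdot\|$ be the spectral norm and put $$\|H\|_1=\sum_{j_1,\dots,j_k}\|H_{j_1,\dots,j_k}\|,\qquad |||H|||_1=\max_{l}\max_{j_l}\sum_{j_1,\dots,j_{l-1},j_{l+1},\dots,j_k}\|H_{j_1,\dots,j_k}\|.$$ List the summands as $H_1,\dots,H_\Gamma$ with $\Gamma=n^k$. A $\Upsilon$-stage product formula is $\mathscr S(t)=\prod_{\upsilon=1}^{\Upsilon}\prod_{\gamma=1}^{\Gamma}e^{-ita_{(\upsilon,\gamma)}H_{\pi_\upsilon(\gamma)}}$ (indices increasing from right to left) with real coefficients $|a_{(\upsilon,\gamma)}|\le 1$ and permutations $\pi_\upsilon$ of $\{1,\dots,\Gamma\}$; it is of order $p$ if $\mathscr S(t)=e^{-itH}+O(t^{p+1})$ as $t\to 0$. An elementary gate is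 a unitary acting nontrivially on at most two qubits. 1. For every $p\ge 1$ there is a constant $C$ depending only on $k,p$ such that $$\widetilde\alpha_{\mathrm{comm}}:=\sum_{\gamma_1,\dots,\gamma_{p+1}=1}^{\Gamma}\big\|[H_{\gamma_{p+1}},\cdots[H_{\gamma_2},H_{\gamma_1}]]\big\|\le C\,|||H|||_1^{\,p}\,\|H\|_1 .$$ 2. For all $p\ge1$ and $\Upsilon$ there is a constant $C$ depending only on $k,p,\Upsilon$ such that every $p$th-order $\Upsilon$-stage product formula satisfies $\|\mathscr S(t)-e^{-itH}\|\le C\,|||H|||_1^{\,p}\|H\|_1t^{p+1}$ for all $t\ge 0$, and $\|\mathscr S(t/r)^r-e^{-itH}\|\le\epsilon$ for all $t\ge0$, $\epsilon>0$ and all integers $r\ge1$ with $r\ge C\,|||H|||_1\|H\|_1^{1/p}t^{1+1/p}/\epsilon^{1/p}$. 3. Each Trotter step, i.e. $\mathscr S(s)$ for any real $s$ and any $\Upsilon$-stage product formula, is implemented exactly by a circuit of at most $Cn^k$ elementary gates, where $C$ depends only on $k,\Upsilon$. 4. The gate complexity is $n^k|||H|||_1\|H\|_1^{o(1)}t^{1+o(1)}$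 at constant accuracy. That is, let $\delta,\epsilon>0$. For all integers $p\ge1$ with $1/p\le\delta$ and all $\Upsilon$ there is a constant $C$ depending only on $k,\delta,\epsilon,p,\Upsilon$ such that for every $p$th-order $\Upsilon$-stage product formula and every $t\ge0$ there are an integer $r\ge1$ with $\|\mathscr S(t/r)^r-e^{-itH}\|\le\epsilon$ and a circuit that implements $\mathscr S(t/r)^r$ exactly with at most $$C\,n^k\max\{1,\ |||H|||_1\|H\|_1^{\delta}t^{1+\delta}\}$$ elementary gates. Moreover, this complexity is attained: for suitable $p\geq 1/\delta$, $\Upsilon$ and $C$ depending only on $k,\delta,\epsilon$ there is, for every $n$, a choice of coefficients and permutations (independent of $H$) whose product formula is of order $p$ and has this property for all $H$ and all $t\ge0$. -/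

import Mathlib

open Asymptotics Topology
open scoped Matrix.Norms.L2Operator

noncomputable section

/-- Operators on `n` qubits: complex matrices in the computational basis, whose elements are the
bit strings `Fin n → Fin 2`. The norm `‖A‖` is the spectral norm (the `L²` operator norm). -/
abbrev QOp (n : ℕ) : Type := Matrix (Fin n → Fin 2) (Fin n → Fin 2) ℂ

/-- `A` acts nontrivially only on the qubits in `S`, that is, `A = B ⊗ 1` for an operator `B` on the
qubits in `S` and the identity on the other qubits. -/
def ActsOnlyOn {n : ℕ} (A : QOp n) (S : Finset (Fin n)) : Prop :=
  ∃ B : Matrix (S → Fin 2) (S → Fin 2) ℂ, ∀ x y : Fin n → Fin 2,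
    ((∀ i, i ∉ S → x i = y i) → A x y = B (fun i => x i) (fun i => y i)) ∧
    ((¬ ∀ i, i ∉ S → x i = y i) → A x y = 0)

/-- A `k`-local Hamiltonian on `n` qubits, given as `H = ∑ H_{j₁,…,j_k}` over all
`j₁, …, j_k ∈ {1, …, n}`, with Hermitian summands such that `H_{j₁,…,j_k}` acts nontrivially only
on the qubits `j₁, …, j_k`. -/
structure LocalHamiltonian (n k : ℕ) where
  term : (Fin k → Fin n) → QOp n
  isHermitian : ∀ j, (term j).IsHermitian
  support : ∀ j, ActsOnlyOn (term j) (Finset.univ.image j)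

/-- The nested commutator `[X_{q+1}, ⋯ [X₂, X₁]]` of `q + 1` operators. -/
def nestedCommutator {d : Type*} [Fintype d] [DecidableEq d] :
    (q : ℕ) → (Fin (q + 1) → Matrix d d ℂ) → Matrix d d ℂ
  | 0, X => X 0
  | q + 1, X => ⁅X (Fin.last (q + 1)), nestedCommutator q (fun i => X i.castSucc)⁆

/-- The data of an `Υ`-stage product formula for `Γ` summands: real coefficients bounded by `1` in
absolute value, and for every stage an ordering of the summands. -/
structure ProductFormula (Υ Γ : ℕ) where
  coeff : Fin Υ → Fin Γ → ℝ
  perm : Fin Υ → Equiv.Perm (Fin Γ)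
  abs_coeff_le_one : ∀ υ γ, |coeff υ γ| ≤ 1

namespace ProductFormula

variable {Υ Γ : ℕ} {d : Type*} [Fintype d] [DecidableEq d]

/-- The operator `S(t) = ∏_υ ∏_γ exp (t a_{(υ,γ)} X_{π_υ(γ)})`. In both products the indices
increase from right to left. -/
def eval (F : ProductFormula Υ Γ) (X : Fin Γ → Matrix d d ℂ) (t : ℝ) : Matrix d d ℂ :=
  (List.ofFn fun υ : Fin Υ =>
    (List.ofFn fun γ : Fin Γ =>
      NormedSpace.exp (((t * F.coeff υ γ : ℝ) : ℂ) • X (F.perm υ γ))).reverse.prod).reverse.prod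

/-- The formula is of order `p` for the summands `X_γ`: `S(t) = exp (t ∑ X_γ) + O(t^{p+1})` as
`t → 0`. -/
def IsOrder (F : ProductFormula Υ Γ) (p : ℕ) (X : Fin Γ → Matrix d d ℂ) : Prop :=
  (fun t : ℝ => F.eval X t - NormedSpace.exp ((t : ℂ) • ∑ γ, X γ)) =O[𝓝 0]
    fun t : ℝ => t ^ (p + 1)

end ProductFormula

/-- An elementary gate on `n` qubits: a unitary that acts nontrivially on at most two qubits. -/
structure QGate (n : ℕ) where
  op : QOp n
  unitary : op ∈ Matrix.unitaryGroup (Fin n → Fin 2) ℂ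
  local_two : ∃ S : Finset (Fin n), S.card ≤ 2 ∧ ActsOnlyOn op S

/-- A circuit is a sequence of elementary gates, the first one being applied first. Its gate count
is the length of the list. -/
abbrev QCircuit (n : ℕ) : Type := List (QGate n)

/-- The unitary that a circuit implements. -/
def QCircuit.toOp {n : ℕ} (c : QCircuit n) : QOp n := (c.map QGate.op).reverse.prod

namespace LocalHamiltonian

variable {n k : ℕ}

/-- The operator `H = ∑ H_{j₁,…,j_k}`. -/
def toOp (H : LocalHamiltonian n k) : QOp n := ∑ j, H.term j

/-- The summands listed as `H_γ` for `γ = 1, …, Γ` with `Γ = n ^ k`. -/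
def summand (H : LocalHamiltonian n k) (γ : Fin (n ^ k)) : QOp n :=
  H.term (finFunctionFinEquiv.symm γ)

/-- The anti-Hermitian summands `-i H_γ` that generate the real-time evolution. -/
def generator (H : LocalHamiltonian n k) (γ : Fin (n ^ k)) : QOp n :=
  (-Complex.I) • H.summand γ

/-- The evolution `exp (-i t H)`. -/
def evolution (H : LocalHamiltonian n k) (t : ℝ) : QOp n :=
  NormedSpace.exp ((-(Complex.I * (t : ℂ))) • H.toOp)

/-- The `1`-norm `‖H‖₁ = ∑ ‖H_{j₁,…,j_k}‖`. -/
def oneNorm (H : LocalHamiltonian n k) : ℝ := ∑ j, ‖H.term j‖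

/-- The induced `1`-norm `max_l max_i ∑ ‖H_{j₁,…,j_k}‖`, where the sum is over all
`j₁, …, j_k` with `j_l = i`. -/
def inducedOneNorm (H : LocalHamiltonian n k) : ℝ :=
  ⨆ l : Fin k, ⨆ i : Fin n, ∑ j : Fin k → Fin n with j l = i, ‖H.term j‖

/-- The sum `∑ ‖[H_{γ_{p+1}}, ⋯ [H_{γ₂}, H_{γ₁}]]‖` over all `γ₁, …, γ_{p+1}`. -/
def alphaComm (H : LocalHamiltonian n k) (p : ℕ) : ℝ :=
  ∑ γ : Fin (p + 1) → Fin (n ^ k), ‖nestedCommutator p (fun i => H.summand (γ i))‖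

/-- The real-time product formula `S(t)` for `H`, which approximates `exp (-i t H)`. -/
def trotterStep {Υ : ℕ} (H : LocalHamiltonian n k) (F : ProductFormula Υ (n ^ k)) (t : ℝ) :
    QOp n :=
  F.eval H.generator t

/-- The product-formula algorithm `S(t/r)^r`, for some number `r` of Trotter steps, simulates
`exp (-i t H)` with accuracy `ε` and is implemented by a circuit with at most `g` gates. -/
def SimulatedWithGates {Υ : ℕ} (H : LocalHamiltonian n k) (F : ProductFormula Υ (n ^ k))
    (t ε g : ℝ) : Prop :=
  ∃ r : ℕ, 0 < r ∧ ∃ c : QCircuit n,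
    c.toOp = H.trotterStep F (t / r) ^ r ∧
    ‖H.trotterStep F (t / r) ^ r - H.evolution t‖ ≤ ε ∧
    (c.length : ℝ) ≤ g

end LocalHamiltonian

end

/-! Error. A product formula is a product `S(t)` of unitary flows, and `S' = G S`, where `G`
(`flowGen`) is a sum of generators conjugated by flows. The relative error `exp(-tH) S(t) - 1` has
derivative `exp(-tH) (G(t) - H) S(t)`, whose norm is `‖G(t) - H‖` by unitarity. Each conjugation in
`G` is Taylor expanded so that every remainder has total order `t ^ p`; these remainders are bounded
by `p`-fold nested commutators (`norm_flowGen_sub_taylor_le`). The order condition kills all lower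
coefficients of `G - H` (`leading_coeff_eq_zero`). Integration gives the commutator bound
`norm_flowProd_sub_flow_le`, without any loss from norms of exponentials.

Locality. A nested commutator of `q + 1` summands lives on at most `(q + 1) k` qubits, and only
summands that meet these qubits fail to commute with it. Their norms add up to at most `k · (q + 1)
k · |||H|||₁`, so each further commutator costs one factor `|||H|||₁` (`alphaComm_le`). Telescoping
over `r` unitary steps then gives the Trotter number.

Gates. Each exponential acts on at most `k` qubits and needs an exact circuit of length bounded in
`k` alone. Near the identity every unitary is a product of rotations about Pauli strings, by a
submersion argument; each such rotation is reduced to two-qubit gates by conjugation, with a length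
independent of the angle; and every exponential is a fixed power of a unitary near the identity
(`exists_hasCircuit_exp`).

Complexity. The number of steps times the gates per step gives the exponent `1/p`, and `|||H|||₁ ≤
‖H‖₁` allows it to be replaced by any `δ ≥ 1/p` (`trotterNumber_le`). Formulas of arbitrarily high
order come from Suzuki's recursion: a symmetric composition has only odd leading errors, so
cancelling one coefficient gains two orders. -/

noncomputable section

/-! ### Commutator bounds for the error of a product of unitary flows. -/

section ProductOfFlows

variable {A : Type*} [CStarAlgebra A]

/-- The one-parameter group `t ↦ exp (t B)`. -/
def flow (B : A) (t : ℝ) : A := NormedSpace.exp ((t : ℂ) • B)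

/-- The linear map `X ↦ B * X - X * B`. -/
def adLin (B : A) : A →ₗ[ℂ] A := LinearMap.mulLeft ℂ B - LinearMap.mulRight ℂ B

@[simp] theorem adLin_apply (B X : A) : adLin B X = B * X - X * B := rfl

@[simp] theorem flow_zero (B : A) : flow B 0 = 1 := by simp [flow]

theorem hasDerivAt_flow (B : A) (t : ℝ) : HasDerivAt (flow B) (B * flow B t) t := by
  have h := hasDerivAt_exp_smul_const' (𝕂 := ℂ) B (t : ℂ)
  exact (HasDerivAt.scomp t h Complex.ofRealCLM.hasDerivAt).congr_deriv (by simp [flow])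

theorem hasDerivAt_flow' (B : A) (t : ℝ) : HasDerivAt (flow B) (flow B t * B) t := by
  have h := hasDerivAt_exp_smul_const (𝕂 := ℂ) B (t : ℂ)
  exact (HasDerivAt.scomp t h Complex.ofRealCLM.hasDerivAt).congr_deriv (by simp [flow])

theorem hasDerivAt_flow_neg (B : A) (t : ℝ) :
    HasDerivAt (fun s => flow B (-s)) (-(flow B (-t) * B)) t := by
  exact (HasDerivAt.scomp t (hasDerivAt_flow' B (-t)) (hasDerivAt_neg t)).congr_deriv (by simp)

theorem flow_add (B : A) (s t : ℝ) : flow B (s + t) = flow B s * flow B t := by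
  let _ : NormedAlgebra ℚ A := NormedAlgebra.restrictScalars ℚ ℂ A
  unfold flow
  rw [← NormedSpace.exp_add_of_commute]
  · rw [← add_smul]; push_cast; rfl
  · exact ((Commute.refl B).smul_left _).smul_right _

theorem flow_mul_flow_neg (B : A) (t : ℝ) : flow B t * flow B (-t) = 1 := by
  rw [← flow_add]; simp

theorem flow_neg_mul_flow (B : A) (t : ℝ) : flow B (-t) * flow B t = 1 := by
  rw [← flow_add]; simp

theorem flow_mem_unitary {B : A} (hB : B ∈ skewAdjoint A) (t : ℝ) : flow B t ∈ unitary A := by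
  let _ : NormedAlgebra ℚ A := NormedAlgebra.restrictScalars ℚ ℂ A
  apply NormedSpace.exp_mem_unitary_of_mem_skewAdjoint
  rw [skewAdjoint.mem_iff] at hB ⊢
  simp [star_smul, hB]

theorem norm_flow_conj {B : A} (hB : B ∈ skewAdjoint A) (t : ℝ) (C : A) :
    ‖flow B t * C * flow B (-t)‖ = ‖C‖ := by
  rw [CStarRing.norm_mul_mem_unitary _ (flow_mem_unitary hB _),
    CStarRing.norm_mem_unitary_mul _ (flow_mem_unitary hB _)]

theorem hasDerivAt_flow_conj (B C : A) (t : ℝ) :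
    HasDerivAt (fun s => flow B s * C * flow B (-s))
      (flow B t * adLin B C * flow B (-t)) t := by
  have h := ((hasDerivAt_flow' B t).mul_const C).mul (hasDerivAt_flow_neg B t)
  have h0 : flow B (-t) * B = B * flow B (-t) :=
    (hasDerivAt_flow' B (-t)).unique (hasDerivAt_flow B (-t))
  refine h.congr_deriv ?_
  rw [h0]
  simp only [adLin_apply]
  noncomm_ring

theorem hasDerivAt_pow_div_factorial_smul (C : A) (r : ℕ) (t : ℝ) :
    HasDerivAt (fun s : ℝ => ((s : ℂ) ^ (r + 1) / ((r + 1).factorial : ℂ)) • C)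
      (((t : ℂ) ^ r / (r.factorial : ℂ)) • C) t := by
  have h1 : HasDerivAt (fun s : ℝ => (s : ℂ) ^ (r + 1)) (((r + 1 : ℕ) : ℂ) * (t : ℂ) ^ r) t := by
    simpa using (HasDerivAt.ofReal_comp (hasDerivAt_pow (r + 1) t))
  have h2 := (h1.div_const ((r + 1).factorial : ℂ)).smul_const C
  refine h2.congr_deriv (congrArg (· • C) ?_)
  have : (r.factorial : ℂ) ≠ 0 := by exact_mod_cast r.factorial_ne_zero
  have h3 : ((r : ℂ) + 1) ≠ 0 := by exact_mod_cast Nat.succ_ne_zero r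
  rw [Nat.factorial_succ]
  push_cast
  field_simp

/-- Taylor expansion of the conjugation `exp (t B) C exp (-t B)` by a unitary group, with the
remainder bounded by a nested commutator. -/
theorem norm_flow_conj_sub_taylor_le {B : A} (hB : B ∈ skewAdjoint A) (m : ℕ) (C : A) {t : ℝ}
    (ht : 0 ≤ t) :
    ‖flow B t * C * flow B (-t) -
        ∑ r ∈ Finset.range m, ((t : ℂ) ^ r / (r.factorial : ℂ)) • (adLin B ^ r) C‖ ≤
      t ^ m / m.factorial * ‖(adLin B ^ m) C‖ := by
  induction m generalizing C t with
  | zero => simp [norm_flow_conj hB]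
  | succ m ih =>
    -- The derivative of the order `m + 1` remainder of `C` is the order `m` remainder of `adLin B
    -- C`, so the induction hypothesis only has to be integrated.
    have hd : ∀ s : ℝ, HasDerivAt (fun s => flow B s * C * flow B (-s) -
        ∑ r ∈ Finset.range (m + 1), ((s : ℂ) ^ r / (r.factorial : ℂ)) • (adLin B ^ r) C)
        (flow B s * adLin B C * flow B (-s) -
          ∑ r ∈ Finset.range m, ((s : ℂ) ^ r / (r.factorial : ℂ)) • (adLin B ^ r) (adLin B C))
        s := by
      intro s
      refine (hasDerivAt_flow_conj B C s).sub ?_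
      simp only [Finset.sum_range_succ']
      have h1 : HasDerivAt (fun s : ℝ => ∑ r ∈ Finset.range m,
          ((s : ℂ) ^ (r + 1) / ((r + 1).factorial : ℂ)) • (adLin B ^ (r + 1)) C)
          (∑ r ∈ Finset.range m, ((s : ℂ) ^ r / (r.factorial : ℂ)) • (adLin B ^ (r + 1)) C) s :=
        HasDerivAt.fun_sum fun r _ => hasDerivAt_pow_div_factorial_smul _ r s
      simpa [pow_succ] using h1
    have hB' : ∀ s : ℝ, HasDerivAt
        (fun s : ℝ => s ^ (m + 1) / (m + 1).factorial * ‖(adLin B ^ (m + 1)) C‖)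
        (s ^ m / m.factorial * ‖(adLin B ^ (m + 1)) C‖) s := by
      intro s
      have h := ((hasDerivAt_pow (m + 1) s).div_const ((m + 1).factorial : ℝ)).mul_const
        ‖(adLin B ^ (m + 1)) C‖
      refine h.congr_deriv (congrArg (· * ‖(adLin B ^ (m + 1)) C‖) ?_)
      have : (m.factorial : ℝ) ≠ 0 := by exact_mod_cast m.factorial_ne_zero
      rw [Nat.factorial_succ]
      push_cast
      field_simp
    refine image_norm_le_of_norm_deriv_right_le_deriv_boundary (a := 0) (b := t)
      (fun s _ => (hd s).continuousAt.continuousWithinAt)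
      (fun s _ => (hd s).hasDerivWithinAt) ?_ hB' ?_ ⟨ht, le_rfl⟩
    · simp [Finset.sum_range_succ']
    · intro s hs
      have := ih (adLin B C) hs.1
      simpa [pow_succ] using this

/-- The product `exp (t B_J) ⋯ exp (t B_1)` for `L = [B_J, …, B_1]`. -/
def flowProd (L : List A) (t : ℝ) : A := (L.map fun B => flow B t).prod

/-- The generator of `flowProd L`, that is, its left logarithmic derivative. -/
def flowGen : List A → ℝ → A
  | [], _ => 0
  | B :: L, t => B + flow B t * flowGen L t * flow B (-t)

/-- The Taylor coefficients of `flowGen L`. -/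
def flowGenCoeff : ℕ → List A → A
  | _, [] => 0
  | q, B :: L => (if q = 0 then B else 0) + ∑ k ∈ Finset.range (q + 1),
      (1 / ((q - k).factorial : ℂ)) • (adLin B ^ (q - k)) (flowGenCoeff k L)

/-- The sum of `φ [B_q, ⋯ [B_1, B_0]]` over all `B_0, …, B_q` in `L`. -/
def commSum : ℕ → List A → Seminorm ℂ A → ℝ
  | 0, L, φ => (L.map φ).sum
  | q + 1, L, φ => (L.map fun B => commSum q L (φ.comp (adLin B))).sum

theorem commSum_nonneg (q : ℕ) (L : List A) (φ : Seminorm ℂ A) : 0 ≤ commSum q L φ := by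
  induction q generalizing φ with
  | zero =>
    refine List.sum_nonneg ?_
    simp only [List.mem_map, forall_exists_index, and_imp]
    rintro _ B - rfl
    exact apply_nonneg φ B
  | succ q ih =>
    refine List.sum_nonneg ?_
    simp only [List.mem_map, forall_exists_index, and_imp]
    rintro _ B - rfl
    exact ih _

theorem commSum_le_cons (q : ℕ) (B : A) (L : List A) (φ : Seminorm ℂ A) :
    commSum q L φ ≤ commSum q (B :: L) φ := by
  induction q generalizing φ with
  | zero => simp [commSum]
  | succ q ih =>
    simp only [commSum, List.map_cons, List.sum_cons]
    refine le_trans ?_ (le_add_of_nonneg_left (commSum_nonneg _ _ _))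
    exact List.sum_le_sum fun X _ => ih _

/-- The left side collects those commutators over `B :: L` whose outermost `q - k` entries are `B`
and whose other entries come from `L`, together with the one built from `B` alone. These are
distinct tuples, so each is counted at most once on the right. -/
theorem sum_commSum_comp_le_commSum_cons (q : ℕ) (B : A) (L : List A) (φ : Seminorm ℂ A) :
    (∑ k ∈ Finset.range (q + 1), commSum k L (φ.comp (adLin B ^ (q - k)))) +
      φ ((adLin B ^ q) B) ≤ commSum q (B :: L) φ := by
  induction q generalizing φ with
  | zero => simp [commSum, Module.End.one_eq_id, add_comm]
  | succ q ih =>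
    have h1 := ih (φ.comp (adLin B))
    have h2 : commSum (q + 1) L φ ≤
        (L.map fun X => commSum q (B :: L) (φ.comp (adLin X))).sum :=
      List.sum_le_sum fun X _ => commSum_le_cons _ _ _ _
    have h3 : ∀ k ∈ Finset.range (q + 1), commSum k L (φ.comp (adLin B ^ (q + 1 - k))) =
        commSum k L ((φ.comp (adLin B)).comp (adLin B ^ (q - k))) := by
      intro k hk
      have hk' : k ≤ q := Nat.lt_succ_iff.mp (Finset.mem_range.mp hk)
      rw [Nat.succ_sub hk', pow_succ']
      rfl
    have h4 : φ.comp (adLin B ^ (q + 1 - (q + 1))) = φ := by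
      ext X; simp
    have h5 : (φ.comp (adLin B)) ((adLin B ^ q) B) = φ ((adLin B ^ (q + 1)) B) := by
      rw [pow_succ']; rfl
    rw [Finset.sum_range_succ, Finset.sum_congr rfl h3, h4]
    rw [h5] at h1
    simp only [commSum, List.map_cons, List.sum_cons] at h2 ⊢
    linarith

theorem seminorm_inv_factorial_smul_le (φ : Seminorm ℂ A) (r : ℕ) (X : A) :
    φ ((1 / (r.factorial : ℂ)) • X) ≤ φ X := by
  rw [map_smul_eq_mul]
  have h1 : (1 : ℝ) ≤ r.factorial := by exact_mod_cast r.factorial_pos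
  have : ‖(1 / (r.factorial : ℂ))‖ ≤ 1 := by
    rw [norm_div, norm_one, Complex.norm_natCast]
    exact (div_le_one (by linarith)).2 h1
  exact mul_le_of_le_one_left (apply_nonneg φ X) this

/-- An arbitrary seminorm is needed for the induction on the list: the outer powers of `adLin B` are
absorbed into `φ`. The inverse factorials are simply dropped. -/
theorem seminorm_flowGenCoeff_le (q : ℕ) (L : List A) (φ : Seminorm ℂ A) :
    φ (flowGenCoeff q L) ≤ commSum q L φ := by
  induction L generalizing q φ with
  | nil => simpa [flowGenCoeff] using commSum_nonneg q [] φ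
  | cons B L ih =>
    refine le_trans ?_ (sum_commSum_comp_le_commSum_cons q B L φ)
    rw [flowGenCoeff, add_comm]
    refine (map_add_le_add φ _ _).trans (add_le_add ?_ ?_)
    · refine (Finset.le_sum_of_subadditive φ (map_zero φ).le (map_add_le_add φ) _ _).trans
        (Finset.sum_le_sum fun k _ => ?_)
      exact (seminorm_inv_factorial_smul_le φ _ _).trans (ih k (φ.comp (adLin B ^ (q - k))))
    · split_ifs with h
      · simp [h]
      · simp

/-- Conjugating by the flow of `B` preserves the norm of the remainder already present for `L`. The
coefficient of `t ^ q` is expanded only to order `p - q`, so its new remainder is of order exactly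
`t ^ p` and involves `p - q` copies of `adLin B`. All these bounds fit into `commSum p (B :: L)`. -/
theorem norm_flowGen_sub_taylor_le {L : List A} (hL : ∀ B ∈ L, B ∈ skewAdjoint A) {p : ℕ}
    (hp : 1 ≤ p) {t : ℝ} (ht : 0 ≤ t) :
    ‖flowGen L t - ∑ q ∈ Finset.range p, ((t : ℂ) ^ q) • flowGenCoeff q L‖ ≤
      t ^ p * commSum p L (normSeminorm ℂ A) := by
  induction L with
  | nil =>
    have := mul_nonneg (pow_nonneg ht p) (commSum_nonneg p ([] : List A) (normSeminorm ℂ A))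
    simpa [flowGen, flowGenCoeff] using this
  | cons B L ih =>
    have hB : B ∈ skewAdjoint A := hL B (by simp)
    have ih' := ih fun X hX => hL X (by simp [hX])
    set R := flowGen L t - ∑ q ∈ Finset.range p, ((t : ℂ) ^ q) • flowGenCoeff q L with hR
    have hG : flowGen L t = R + ∑ q ∈ Finset.range p, ((t : ℂ) ^ q) • flowGenCoeff q L := by
      rw [hR]; abel
    have hcoef : ∑ q ∈ Finset.range p, ((t : ℂ) ^ q) • flowGenCoeff q (B :: L) =
        B + ∑ q ∈ Finset.range p, ((t : ℂ) ^ q) • ∑ r ∈ Finset.range (p - q),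
          ((t : ℂ) ^ r / (r.factorial : ℂ)) • (adLin B ^ r) (flowGenCoeff q L) := by
      simp only [flowGenCoeff, smul_add, Finset.sum_add_distrib]
      congr 1
      · rw [Finset.sum_eq_single_of_mem 0 (Finset.mem_range.2 hp)]
        · simp
        · intro q _ hq; simp [hq]
      · have := Finset.sum_range_diag_flip p fun q r => ((t : ℂ) ^ q) •
          (((t : ℂ) ^ r / (r.factorial : ℂ)) • (adLin B ^ r) (flowGenCoeff q L))
        simp only [Finset.smul_sum]
        rw [← this]
        refine Finset.sum_congr rfl fun q _ => Finset.sum_congr rfl fun k hk => ?_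
        have hk' : k ≤ q := Nat.lt_succ_iff.mp (Finset.mem_range.mp hk)
        rw [smul_smul, smul_smul]
        congr 1
        rw [mul_one_div, mul_div_assoc', ← pow_add, Nat.add_sub_cancel' hk']
    have hsplit : flowGen (B :: L) t -
        ∑ q ∈ Finset.range p, ((t : ℂ) ^ q) • flowGenCoeff q (B :: L) =
        flow B t * R * flow B (-t) + ∑ q ∈ Finset.range p, ((t : ℂ) ^ q) •
          (flow B t * flowGenCoeff q L * flow B (-t) - ∑ r ∈ Finset.range (p - q),
            ((t : ℂ) ^ r / (r.factorial : ℂ)) • (adLin B ^ r) (flowGenCoeff q L)) := by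
      rw [hcoef, flowGen, hG]
      simp only [mul_add, add_mul, Finset.mul_sum, Finset.sum_mul, smul_sub,
        Finset.sum_sub_distrib, mul_smul_comm, smul_mul_assoc]
      abel
    rw [hsplit]
    have hterm : ∀ q ∈ Finset.range p, ‖((t : ℂ) ^ q) •
          (flow B t * flowGenCoeff q L * flow B (-t) - ∑ r ∈ Finset.range (p - q),
            ((t : ℂ) ^ r / (r.factorial : ℂ)) • (adLin B ^ r) (flowGenCoeff q L))‖ ≤
        t ^ p * commSum q L ((normSeminorm ℂ A).comp (adLin B ^ (p - q))) := by
      intro q hq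
      have hq' : q ≤ p := (Finset.mem_range.mp hq).le
      have h1 := norm_flow_conj_sub_taylor_le hB (p - q) (flowGenCoeff q L) ht
      have h2 := seminorm_flowGenCoeff_le q L ((normSeminorm ℂ A).comp (adLin B ^ (p - q)))
      have h2' : ‖(adLin B ^ (p - q)) (flowGenCoeff q L)‖ ≤
        commSum q L ((normSeminorm ℂ A).comp (adLin B ^ (p - q))) := h2
      have h3 : t ^ (p - q) / (p - q).factorial ≤ t ^ (p - q) :=
        div_le_self (pow_nonneg ht _) (by exact_mod_cast (p - q).factorial_pos)
      rw [norm_smul, norm_pow, Complex.norm_real, Real.norm_of_nonneg ht]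
      calc _ ≤ t ^ q * (t ^ (p - q) *
            commSum q L ((normSeminorm ℂ A).comp (adLin B ^ (p - q)))) := by
              gcongr
              exact h1.trans (mul_le_mul h3 h2' (norm_nonneg _) (pow_nonneg ht _))
        _ = _ := by rw [← mul_assoc, ← pow_add, Nat.add_sub_cancel' hq']
    have hfin := sum_commSum_comp_le_commSum_cons p B L (normSeminorm ℂ A)
    have hlast : (normSeminorm ℂ A).comp (adLin B ^ (p - p)) = normSeminorm ℂ A := by
      ext X; simp
    rw [Finset.sum_range_succ, hlast] at hfin
    calc _ ≤ t ^ p * commSum p L (normSeminorm ℂ A) + ∑ q ∈ Finset.range p,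
          t ^ p * commSum q L ((normSeminorm ℂ A).comp (adLin B ^ (p - q))) := by
            refine (norm_add_le _ _).trans (add_le_add ?_ ?_)
            · rw [norm_flow_conj hB]; exact ih'
            · exact norm_sum_le_of_le _ hterm
      _ = t ^ p * (∑ q ∈ Finset.range p,
          commSum q L ((normSeminorm ℂ A).comp (adLin B ^ (p - q))) +
            commSum p L (normSeminorm ℂ A)) := by
            rw [mul_add, Finset.mul_sum, add_comm]
      _ ≤ _ := by
            refine mul_le_mul_of_nonneg_left ?_ (pow_nonneg ht _)
            have := apply_nonneg (normSeminorm ℂ A) ((adLin B ^ p) B)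
            linarith

theorem flowProd_mem_unitary {L : List A} (hL : ∀ B ∈ L, B ∈ skewAdjoint A) (t : ℝ) :
    flowProd L t ∈ unitary A := by
  refine Submonoid.list_prod_mem _ ?_
  simp only [List.mem_map, forall_exists_index, and_imp]
  rintro _ B hB rfl
  exact flow_mem_unitary (hL B hB) t

theorem hasDerivAt_flowProd (L : List A) (t : ℝ) :
    HasDerivAt (flowProd L) (flowGen L t * flowProd L t) t := by
  induction L with
  | nil =>
    have : flowProd ([] : List A) = fun _ => 1 := rfl
    rw [this]
    exact (hasDerivAt_const t (1 : A)).congr_deriv (by simp [flowGen])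
  | cons B L ih =>
    have h := (hasDerivAt_flow B t).mul ih
    have : flowProd (B :: L) = fun s => flow B s * flowProd L s := by
      ext s; simp [flowProd]
    rw [this]
    refine h.congr_deriv ?_
    rw [flowGen, add_mul]
    congr 1
    · simp [mul_assoc]
    · rw [mul_assoc (flow B t * flowGen L t), ← mul_assoc (flow B (-t)), flow_neg_mul_flow,
        one_mul, mul_assoc]

@[simp] theorem flowProd_zero (L : List A) : flowProd L 0 = 1 := by
  induction L with
  | nil => rfl
  | cons B L ih => simp [flowProd]

/-- The derivative of the relative error `exp (-t H) S(t) - 1` of a product of flows. -/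
theorem hasDerivAt_flow_neg_mul_flowProd (H : A) (L : List A) (t : ℝ) :
    HasDerivAt (fun s => flow H (-s) * flowProd L s - 1)
      (flow H (-t) * (flowGen L t - H) * flowProd L t) t := by
  have h := ((hasDerivAt_flow_neg H t).mul (hasDerivAt_flowProd L t)).sub_const 1
  refine h.congr_deriv ?_
  noncomm_ring

/-- If the relative error vanishes to order `p + 1` and its derivative is
`exp (-t H) (t ^ m d + O(t ^ (m + 1))) S(t)` with `m < p`, then `d = 0`. -/
theorem leading_coeff_eq_zero {H : A} (hH : H ∈ skewAdjoint A) {L : List A}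
    (hL : ∀ B ∈ L, B ∈ skewAdjoint A) {p m : ℕ} (hm : m < p)
    (hord : (fun t : ℝ => flow H (-t) * flowProd L t - 1) =O[𝓝 0] fun t : ℝ => t ^ (p + 1))
    {d : A} {K : ℝ}
    (hd : ∀ t : ℝ, 0 ≤ t → t ≤ 1 →
      ‖flowGen L t - H - ((t : ℂ) ^ m) • d‖ ≤ K * t ^ (m + 1)) : d = 0 := by
  obtain ⟨M, hM⟩ := hord.bound
  have hK : 0 ≤ K := by
    have := (norm_nonneg _).trans (hd 1 zero_le_one le_rfl)
    simpa using this
  rw [← norm_le_zero_iff]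
  -- Integrating the derivative shows that `t ^ (m + 1) / (m + 1) • d` differs from the relative
  -- error by at most `η / 2 * t ^ (m + 1) / (m + 1)`. The relative error itself is at most `|M| * t
  -- * t ^ (m + 1)`, so dividing leaves `‖d‖ ≤ (m + 1) * |M| * t + η / 2`.
  refine le_of_forall_pos_le_add fun η hη => ?_
  have hcont : Filter.Tendsto (fun s : ℝ => flow H (-s) * d * flowProd L s - d) (𝓝 0) (𝓝 0) := by
    have h1 : ContinuousAt (fun s : ℝ => flow H (-s) * d * flowProd L s - d) 0 :=
      ((((hasDerivAt_flow_neg H 0).continuousAt).mul continuousAt_const).mul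
        (hasDerivAt_flowProd L 0).continuousAt).sub continuousAt_const
    simpa [ContinuousAt] using h1
  have hc1 : ∀ᶠ s : ℝ in 𝓝 0, ‖flow H (-s) * d * flowProd L s - d‖ < η / 4 := by
    have := hcont.norm
    rw [norm_zero] at this
    exact this.eventually (gt_mem_nhds (by positivity))
  have hc2 : ∀ᶠ s : ℝ in 𝓝 0, K * s < η / 4 := by
    have : Filter.Tendsto (fun s : ℝ => K * s) (𝓝 0) (𝓝 0) := by
      simpa using (show Continuous fun s : ℝ => K * s by fun_prop).tendsto 0
    exact this.eventually (gt_mem_nhds (by positivity))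
  have hc3 : ∀ᶠ s : ℝ in 𝓝 0, (m + 1) * |M| * s < η / 2 := by
    have : Filter.Tendsto (fun s : ℝ => (m + 1) * |M| * s) (𝓝 0) (𝓝 0) := by
      simpa using (show Continuous fun s : ℝ => (m + 1) * |M| * s by fun_prop).tendsto 0
    exact this.eventually (gt_mem_nhds (by positivity))
  obtain ⟨τ, hτ, hall⟩ := Metric.eventually_nhds_iff.mp (hM.and (hc1.and (hc2.and hc3)))
  set t : ℝ := min (τ / 2) 1 with ht
  have ht0 : 0 < t := lt_min (by positivity) one_pos
  have ht1 : t ≤ 1 := min_le_right _ _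
  have htτ : t < τ := (min_le_left _ _).trans_lt (by linarith)
  have hall' : ∀ s ∈ Set.Icc 0 t, _ := fun s hs => hall (y := s) (by
    rw [Real.dist_eq, sub_zero, abs_of_nonneg hs.1]; exact hs.2.trans_lt htτ)
  have hder : ∀ s : ℝ, HasDerivAt (fun s : ℝ => flow H (-s) * flowProd L s - 1 -
      ((s : ℂ) ^ (m + 1) / ((m + 1).factorial : ℂ)) • ((m.factorial : ℂ) • d))
      (flow H (-s) * (flowGen L s - H) * flowProd L s - ((s : ℂ) ^ m) • d) s := by
    intro s
    refine ((hasDerivAt_flow_neg_mul_flowProd H L s).sub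
      (hasDerivAt_pow_div_factorial_smul _ m s)).congr_deriv ?_
    rw [smul_smul, div_mul_cancel₀]
    exact_mod_cast m.factorial_ne_zero
  have hbd : ∀ s ∈ Set.Ico 0 t, ‖flow H (-s) * (flowGen L s - H) * flowProd L s -
      ((s : ℂ) ^ m) • d‖ ≤ η / 2 * s ^ m := by
    intro s hs
    obtain ⟨-, h1, h2, -⟩ := hall' s ⟨hs.1, hs.2.le⟩
    have h3 := hd s hs.1 (hs.2.le.trans ht1)
    have hsplit : flow H (-s) * (flowGen L s - H) * flowProd L s - ((s : ℂ) ^ m) • d =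
        flow H (-s) * (flowGen L s - H - ((s : ℂ) ^ m) • d) * flowProd L s +
          ((s : ℂ) ^ m) • (flow H (-s) * d * flowProd L s - d) := by
      simp only [mul_sub, sub_mul, smul_sub, mul_smul_comm, smul_mul_assoc]
      abel
    have hsm : 0 ≤ s ^ m := pow_nonneg hs.1 m
    rw [hsplit]
    refine (norm_add_le _ _).trans ?_
    rw [CStarRing.norm_mul_mem_unitary _ (flowProd_mem_unitary hL _),
      CStarRing.norm_mem_unitary_mul _ (flow_mem_unitary hH _), norm_smul, norm_pow,
      Complex.norm_real, Real.norm_of_nonneg hs.1]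
    have h4 : K * s ^ (m + 1) ≤ η / 4 * s ^ m := by
      rw [pow_succ', ← mul_assoc]
      exact mul_le_mul_of_nonneg_right h2.le hsm
    have h5 : s ^ m * ‖flow H (-s) * d * flowProd L s - d‖ ≤ s ^ m * (η / 4) :=
      mul_le_mul_of_nonneg_left h1.le hsm
    linarith
  have hB' : ∀ s : ℝ, HasDerivAt (fun s : ℝ => η / 2 * (s ^ (m + 1) / (m + 1)))
      (η / 2 * s ^ m) s := by
    intro s
    refine (((hasDerivAt_pow (m + 1) s).div_const ((m : ℝ) + 1)).const_mul (η / 2)).congr_deriv ?_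
    have : (m : ℝ) + 1 ≠ 0 := by positivity
    push_cast
    field_simp
  have hmain := image_norm_le_of_norm_deriv_right_le_deriv_boundary (a := 0) (b := t)
      (fun s _ => (hder s).continuousAt.continuousWithinAt)
      (fun s _ => (hder s).hasDerivWithinAt) (by simp) hB' hbd ⟨ht0.le, le_rfl⟩
  obtain ⟨hE, -, -, h3⟩ := hall' t ⟨ht0.le, le_rfl⟩
  have hcoef : ‖((t : ℂ) ^ (m + 1) / ((m + 1).factorial : ℂ)) • ((m.factorial : ℂ) • d)‖ =
      t ^ (m + 1) / (m + 1) * ‖d‖ := by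
    rw [smul_smul, norm_smul, norm_mul, norm_div, norm_pow, Complex.norm_real,
      Complex.norm_natCast, Complex.norm_natCast, Real.norm_of_nonneg ht0.le, Nat.factorial_succ]
    have : (m.factorial : ℝ) ≠ 0 := by exact_mod_cast m.factorial_ne_zero
    push_cast
    field_simp
  have hE' : ‖flow H (-t) * flowProd L t - 1‖ ≤ |M| * t * t ^ (m + 1) := by
    refine hE.trans ?_
    rw [norm_pow, Real.norm_of_nonneg ht0.le, mul_assoc, ← pow_succ']
    have h6 : t ^ (p + 1) ≤ t ^ (m + 1 + 1) := pow_le_pow_of_le_one ht0.le ht1 (by omega)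
    exact mul_le_mul (le_abs_self M) h6 (pow_nonneg ht0.le _) (abs_nonneg M)
  have htri := norm_sub_norm_le
    (((t : ℂ) ^ (m + 1) / ((m + 1).factorial : ℂ)) • ((m.factorial : ℂ) • d))
    (flow H (-t) * flowProd L t - 1)
  rw [norm_sub_rev (_ • _), hcoef] at htri
  have hm1 : (0 : ℝ) < m + 1 := by positivity
  have htm : 0 < t ^ (m + 1) := pow_pos ht0 _
  have hfin : t ^ (m + 1) / (m + 1) * ‖d‖ ≤
      t ^ (m + 1) / (m + 1) * ((m + 1) * |M| * t + η / 2) := by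
    have : t ^ (m + 1) / (m + 1) * ((m + 1) * |M| * t + η / 2) =
        |M| * t * t ^ (m + 1) + η / 2 * (t ^ (m + 1) / (m + 1)) := by
      field_simp
    rw [this]
    linarith
  have := le_of_mul_le_mul_left hfin (by positivity)
  linarith

theorem norm_flowGen_sub_le {H : A} (hH : H ∈ skewAdjoint A) {L : List A}
    (hL : ∀ B ∈ L, B ∈ skewAdjoint A) {p : ℕ} (hp : 1 ≤ p)
    (hord : (fun t : ℝ => flow H (-t) * flowProd L t - 1) =O[𝓝 0] fun t : ℝ => t ^ (p + 1))
    {t : ℝ} (ht : 0 ≤ t) :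
    ‖flowGen L t - H‖ ≤ t ^ p * commSum p L (normSeminorm ℂ A) := by
  set d : ℕ → A := fun q => flowGenCoeff q L - if q = 0 then H else 0 with hdef
  have hsum : ∀ t : ℝ, ∑ q ∈ Finset.range p, ((t : ℂ) ^ q) • flowGenCoeff q L =
      H + ∑ q ∈ Finset.range p, ((t : ℂ) ^ q) • d q := by
    intro t
    simp only [hdef, smul_sub, Finset.sum_sub_distrib]
    have : ∑ q ∈ Finset.range p, ((t : ℂ) ^ q) • (if q = 0 then H else 0) = H := by
      rw [Finset.sum_eq_single_of_mem 0 (Finset.mem_range.2 hp)]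
      · simp
      · intro q _ hq; simp [hq]
    rw [this]; abel
  have hrem : ∀ t : ℝ, 0 ≤ t →
      ‖flowGen L t - H - ∑ q ∈ Finset.range p, ((t : ℂ) ^ q) • d q‖ ≤
        t ^ p * commSum p L (normSeminorm ℂ A) := by
    intro t ht
    have := norm_flowGen_sub_taylor_le hL hp ht
    rwa [hsum, ← sub_sub] at this
  -- Strong induction makes `d m` the leading coefficient. For `t ≤ 1` the higher terms and the
  -- remainder are all `O(t ^ (m + 1))`, which gives the constant `K`.
  have hzero : ∀ m, m < p → d m = 0 := by
    intro m
    induction m using Nat.strong_induction_on with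
    | _ m ih =>
      intro hm
      refine leading_coeff_eq_zero hH hL hm hord
        (K := commSum p L (normSeminorm ℂ A) + ∑ q ∈ Finset.range p, ‖d q‖) ?_
      intro t ht ht1
      have h1 := hrem t ht
      have h2 : ∑ q ∈ Finset.range p, ((t : ℂ) ^ q) • d q = ((t : ℂ) ^ m) • d m +
          ∑ q ∈ (Finset.range p).erase m, ((t : ℂ) ^ q) • d q :=
        (Finset.add_sum_erase _ _ (Finset.mem_range.2 hm)).symm
      have h3 : ‖∑ q ∈ (Finset.range p).erase m, ((t : ℂ) ^ q) • d q‖ ≤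
          t ^ (m + 1) * ∑ q ∈ Finset.range p, ‖d q‖ := by
        rw [Finset.mul_sum]
        refine (norm_sum_le _ _).trans ((Finset.sum_le_sum fun q hq => ?_).trans
          (Finset.sum_le_sum_of_subset_of_nonneg (Finset.erase_subset m _)
            fun q _ _ => by positivity))
        rcases lt_or_gt_of_ne (Finset.ne_of_mem_erase hq) with hlt | hgt
        · rw [ih q hlt (hlt.trans hm)]; simp
        · rw [norm_smul, norm_pow, Complex.norm_real, Real.norm_of_nonneg ht]
          exact mul_le_mul_of_nonneg_right (pow_le_pow_of_le_one ht ht1 hgt) (norm_nonneg _)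
      have h4 : flowGen L t - H - ((t : ℂ) ^ m) • d m =
          (flowGen L t - H - ∑ q ∈ Finset.range p, ((t : ℂ) ^ q) • d q) +
            ∑ q ∈ (Finset.range p).erase m, ((t : ℂ) ^ q) • d q := by
        rw [h2]; abel
      have h5 : t ^ p ≤ t ^ (m + 1) := pow_le_pow_of_le_one ht ht1 hm
      rw [h4]
      calc _ ≤ _ := norm_add_le _ _
        _ ≤ t ^ (m + 1) * commSum p L (normSeminorm ℂ A) +
            t ^ (m + 1) * ∑ q ∈ Finset.range p, ‖d q‖ :=
          add_le_add (h1.trans (mul_le_mul_of_nonneg_right h5 (commSum_nonneg _ _ _))) h3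
        _ = _ := by ring
  have h := hrem t ht
  rwa [Finset.sum_eq_zero, sub_zero] at h
  intro q hq
  rw [hzero q (Finset.mem_range.1 hq), smul_zero]

/-- **Trotter error with commutator scaling.** A product of unitary flows that agrees with the flow
of `H` up to `O(t ^ (p + 1))` has error at most `t ^ (p + 1)` times a sum of norms of nested
commutators. -/
theorem norm_flowProd_sub_flow_le {H : A} (hH : H ∈ skewAdjoint A) {L : List A}
    (hL : ∀ B ∈ L, B ∈ skewAdjoint A) {p : ℕ} (hp : 1 ≤ p)
    (hord : (fun t : ℝ => flowProd L t - flow H t) =O[𝓝 0] fun t : ℝ => t ^ (p + 1))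
    {t : ℝ} (ht : 0 ≤ t) :
    ‖flowProd L t - flow H t‖ ≤ commSum p L (normSeminorm ℂ A) * t ^ (p + 1) := by
  have hrel : ∀ s : ℝ, flow H (-s) * (flowProd L s - flow H s) =
      flow H (-s) * flowProd L s - 1 := by
    intro s; rw [mul_sub, flow_neg_mul_flow]
  have hnorm : ∀ s : ℝ, ‖flow H (-s) * flowProd L s - 1‖ = ‖flowProd L s - flow H s‖ := by
    intro s
    rw [← hrel, CStarRing.norm_mem_unitary_mul _ (flow_mem_unitary hH _)]
  have hord' : (fun t : ℝ => flow H (-t) * flowProd L t - 1) =O[𝓝 0] fun t : ℝ => t ^ (p + 1) :=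
    (IsBigO.of_norm_left (by simpa only [hnorm] using hord.norm_left))
  have hbd : ∀ s ∈ Set.Ico 0 t, ‖flow H (-s) * (flowGen L s - H) * flowProd L s‖ ≤
      s ^ p * commSum p L (normSeminorm ℂ A) := by
    intro s hs
    rw [CStarRing.norm_mul_mem_unitary _ (flowProd_mem_unitary hL _),
      CStarRing.norm_mem_unitary_mul _ (flow_mem_unitary hH _)]
    exact norm_flowGen_sub_le hH hL hp hord' hs.1
  have hB' : ∀ s : ℝ, HasDerivAt
      (fun s : ℝ => s ^ (p + 1) / (p + 1) * commSum p L (normSeminorm ℂ A))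
      (s ^ p * commSum p L (normSeminorm ℂ A)) s := by
    intro s
    refine (((hasDerivAt_pow (p + 1) s).div_const ((p : ℝ) + 1)).mul_const _).congr_deriv ?_
    have : (p : ℝ) + 1 ≠ 0 := by positivity
    push_cast
    field_simp
  have hmain := image_norm_le_of_norm_deriv_right_le_deriv_boundary (a := 0) (b := t)
      (fun s _ => (hasDerivAt_flow_neg_mul_flowProd H L s).continuousAt.continuousWithinAt)
      (fun s _ => (hasDerivAt_flow_neg_mul_flowProd H L s).hasDerivWithinAt)
      (by simp) hB' hbd ⟨ht, le_rfl⟩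
  rw [← hnorm]
  refine hmain.trans ?_
  rw [mul_comm]
  refine mul_le_mul_of_nonneg_left ?_ (commSum_nonneg _ _ _)
  exact div_le_self (pow_nonneg ht _) (by linarith [(Nat.cast_nonneg p : (0 : ℝ) ≤ p)])

end ProductOfFlows

/-! ### Suzuki's symmetric composition. -/

section SymmetricComposition

variable {A : Type*} [CStarAlgebra A]

theorem analyticAt_flow (B : A) (t : ℝ) : AnalyticAt ℝ (flow B) t := by
  have h1 : AnalyticAt ℝ (NormedSpace.exp : A → A) ((t : ℂ) • B) :=
    (NormedSpace.exp_analytic (𝕂 := ℂ) _).restrictScalars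
  have h2 : AnalyticAt ℝ (fun s : ℝ => (s : ℂ) • B) t :=
    (Complex.ofRealCLM.analyticAt t).smul analyticAt_const
  exact AnalyticAt.fun_comp (f := fun s : ℝ => (s : ℂ) • B) h1 h2

/-- `f (t) = exp (a t H) + t ^ m (w + O(t))` with an analytic error term. -/
def FlowApprox (H : A) (a : ℝ) (m : ℕ) (f : ℝ → A) (w : A) : Prop :=
  ∃ g : ℝ → A, AnalyticAt ℝ g 0 ∧ g 0 = w ∧ ∀ t, f t = flow H (a * t) + ((t : ℂ) ^ m) • g t

theorem analyticAt_flow_mul (H : A) (a t : ℝ) : AnalyticAt ℝ (fun s => flow H (a * s)) t :=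
  AnalyticAt.fun_comp (f := fun s : ℝ => a * s) (analyticAt_flow H (a * t)) (by fun_prop)

theorem analyticAt_ofReal_pow (m : ℕ) (t : ℝ) : AnalyticAt ℝ (fun s : ℝ => (s : ℂ) ^ m) t :=
  (Complex.ofRealCLM.analyticAt t).pow m

/-- Leading errors add because both flows equal `1` at time zero and the product of the two errors
carries an extra factor `t ^ m`. -/
theorem FlowApprox.mul {H : A} {a b : ℝ} {m : ℕ} (hm : 1 ≤ m) {f₁ f₂ : ℝ → A} {w₁ w₂ : A}
    (h₁ : FlowApprox H a m f₁ w₁) (h₂ : FlowApprox H b m f₂ w₂) :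
    FlowApprox H (a + b) m (fun t => f₁ t * f₂ t) (w₁ + w₂) := by
  obtain ⟨g₁, hg₁, hw₁, he₁⟩ := h₁
  obtain ⟨g₂, hg₂, hw₂, he₂⟩ := h₂
  refine ⟨fun t => g₁ t * flow H (b * t) + flow H (a * t) * g₂ t + ((t : ℂ) ^ m) • (g₁ t * g₂ t),
    ?_, ?_, ?_⟩
  · exact ((hg₁.mul (analyticAt_flow_mul H b 0)).add ((analyticAt_flow_mul H a 0).mul hg₂)).add
      ((analyticAt_ofReal_pow m 0).smul (hg₁.mul hg₂))
  · have : m ≠ 0 := by omega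
    simp [hw₁, hw₂, this]
  · intro t
    dsimp only
    rw [he₁, he₂, add_mul a b t, flow_add]
    simp only [mul_add, add_mul, smul_add, mul_smul_comm, smul_mul_assoc]
    abel

theorem FlowApprox.scale {H : A} {m : ℕ} {f : ℝ → A} {w : A} (h : FlowApprox H 1 m f w) (u : ℝ) :
    FlowApprox H u m (fun t => f (u * t)) (((u : ℂ) ^ m) • w) := by
  obtain ⟨g, hg, hw, he⟩ := h
  refine ⟨fun t => ((u : ℂ) ^ m) • g (u * t), ?_, by simp [hw], ?_⟩
  · have h1 : AnalyticAt ℝ (fun s : ℝ => g (u * s)) 0 :=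
      AnalyticAt.fun_comp (g := g) (f := fun s : ℝ => u * s) (by simpa using hg) (by fun_prop)
    exact AnalyticAt.smul (f := fun _ : ℝ => (u : ℂ) ^ m) analyticAt_const h1
  · intro t
    dsimp only
    rw [he, one_mul, smul_smul]
    congr 2
    push_cast
    ring

/-- An analytic function that vanishes at the origin is divisible by `t`. -/
theorem exists_eq_smul_of_analyticAt {g : ℝ → A} (hg : AnalyticAt ℝ g 0) (h0 : g 0 = 0) :
    ∃ h : ℝ → A, AnalyticAt ℝ h 0 ∧ ∀ t, g t = (t : ℂ) • h t := by
  have h1 : ((1 : ℕ) : ℕ∞) ≤ analyticOrderAt g 0 := by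
    rw [Nat.cast_one, Order.one_le_iff_ne_zero]
    exact analyticOrderAt_ne_zero.2 ⟨hg, h0⟩
  obtain ⟨h, hh, he⟩ := (natCast_le_analyticOrderAt hg).1 h1
  -- The local quotient is replaced by `g t / t` off the origin, so that the factorisation holds for
  -- every `t`.
  refine ⟨fun t => if t = 0 then h 0 else ((t : ℂ)⁻¹) • g t, ?_, ?_⟩
  · refine hh.congr ?_
    filter_upwards [he] with t ht
    split_ifs with h2
    · rw [h2]
    · rw [ht, sub_zero, pow_one, ← Complex.coe_smul, smul_smul, inv_mul_cancel₀, one_smul]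
      exact_mod_cast h2
  · intro t
    dsimp only
    split_ifs with h2
    · simp [h2, h0]
    · rw [smul_smul, mul_inv_cancel₀, one_smul]
      exact_mod_cast h2

theorem FlowApprox.succ {H : A} {a : ℝ} {m : ℕ} {f : ℝ → A} (h : FlowApprox H a m f 0) :
    ∃ w, FlowApprox H a (m + 1) f w := by
  obtain ⟨g, hg, hw, he⟩ := h
  obtain ⟨h', hh, heq⟩ := exists_eq_smul_of_analyticAt hg hw
  exact ⟨h' 0, h', hh, rfl, fun t => by rw [he, heq, smul_smul, pow_succ]⟩

/-- The error of a symmetric approximation starts with an odd power of `t`. -/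
theorem FlowApprox.eq_zero_of_symm {H : A} {m : ℕ} (hm : 1 ≤ m) (heven : Even m) {f : ℝ → A}
    {w : A} (h : FlowApprox H 1 m f w) (hf : ∀ t, f t * f (-t) = 1) : w = 0 := by
  obtain ⟨g, hg, hw, he⟩ := h
  -- Since `m` is even, both factors of `f t * f (-t) = 1` carry the same `t ^ m`, which can be
  -- cancelled; the limit `t → 0` then reads `w + w = 0`.
  have key : ∀ t : ℝ, t ≠ 0 →
      flow H t * g (-t) + g t * flow H (-t) + ((t : ℂ) ^ m) • (g t * g (-t)) = 0 := by
    intro t ht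
    have h1 := hf t
    rw [he, he] at h1
    have h2 : ((-t : ℝ) : ℂ) ^ m = (t : ℂ) ^ m := by push_cast; exact heven.neg_pow _
    rw [h2, one_mul, one_mul] at h1
    have h3 : ((t : ℂ) ^ m) •
        (flow H t * g (-t) + g t * flow H (-t) + ((t : ℂ) ^ m) • (g t * g (-t))) = 0 := by
      have h4 := flow_mul_flow_neg H t
      simp only [mul_add, add_mul, mul_smul_comm, smul_mul_assoc, h4] at h1
      simp only [smul_add]
      rw [add_assoc, add_eq_left] at h1
      rw [← h1, smul_add]; abel
    have h5 : ((t : ℂ) ^ m) ≠ 0 := pow_ne_zero _ (by exact_mod_cast ht)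
    exact (smul_eq_zero.1 h3).resolve_left h5
  have hgc := hg.continuousAt
  have hgn : ContinuousAt (fun t : ℝ => g (-t)) 0 :=
    ContinuousAt.comp (f := fun t : ℝ => -t) (by simpa using hgc) continuous_neg.continuousAt
  have hc : ContinuousAt (fun t : ℝ =>
      flow H t * g (-t) + g t * flow H (-t) + ((t : ℂ) ^ m) • (g t * g (-t))) 0 :=
    (((hasDerivAt_flow H 0).continuousAt.mul hgn).add
      (hgc.mul (hasDerivAt_flow_neg H 0).continuousAt)).add
      ((analyticAt_ofReal_pow m 0).continuousAt.smul (hgc.mul hgn))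
  have hlim : Filter.Tendsto (fun t : ℝ =>
      flow H t * g (-t) + g t * flow H (-t) + ((t : ℂ) ^ m) • (g t * g (-t))) (𝓝[≠] 0) (𝓝 0) := by
    refine Filter.Tendsto.congr' ?_ tendsto_const_nhds
    filter_upwards [self_mem_nhdsWithin] with t ht
    exact (key t ht).symm
  have h0 := tendsto_nhds_unique (hc.tendsto.mono_left nhdsWithin_le_nhds) hlim
  have hm0 : m ≠ 0 := by omega
  simp only [flow_zero, neg_zero, one_mul, mul_one, Complex.ofReal_zero, zero_pow hm0, zero_smul,
    add_zero, hw] at h0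
  have h2 : (2 : ℂ) • w = 0 := by rw [two_smul]; exact h0
  exact (smul_eq_zero.1 h2).resolve_left two_ne_zero

/-- The first order is gained from the vanishing coefficient, the second because the next exponent
`m + 1` is even and symmetry excludes it. -/
theorem FlowApprox.add_two_of_symm {H : A} {m : ℕ} (hodd : Odd m) {f : ℝ → A}
    (h : FlowApprox H 1 m f 0) (hf : ∀ t, f t * f (-t) = 1) :
    ∃ w, FlowApprox H 1 (m + 2) f w := by
  obtain ⟨w, hw⟩ := h.succ
  have := hw.eq_zero_of_symm (by omega) hodd.add_one hf
  subst this
  exact hw.succ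

theorem FlowApprox.isBigO {H : A} {m : ℕ} {f : ℝ → A} {w : A} (h : FlowApprox H 1 m f w) :
    (fun t : ℝ => f t - flow H t) =O[𝓝 0] fun t : ℝ => t ^ m := by
  obtain ⟨g, hg, -, he⟩ := h
  have h1 : (fun t : ℝ => f t - flow H t) = fun t : ℝ => (t ^ m) • g t := by
    ext t
    rw [he, one_mul, add_sub_cancel_left, ← Complex.coe_smul, Complex.ofReal_pow]
  rw [h1]
  simpa using (isBigO_refl (fun t : ℝ => t ^ m) (𝓝 0)).smul (hg.continuousAt.isBigO_one ℝ)

/-- Suzuki's fivefold composition. -/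
def suzukiStep (u : ℝ) (f : ℝ → A) (t : ℝ) : A :=
  f (u * t) * (f (u * t) * (f ((1 - 4 * u) * t) * (f (u * t) * f (u * t))))

theorem suzukiStep_symm {u : ℝ} {f : ℝ → A} (hf : ∀ t, f t * f (-t) = 1) (t : ℝ) :
    suzukiStep u f t * suzukiStep u f (-t) = 1 := by
  have h1 := hf (u * t)
  have h2 := hf ((1 - 4 * u) * t)
  simp only [suzukiStep, mul_neg]
  generalize f (u * t) = x at *
  generalize f (-(u * t)) = x' at *
  generalize f ((1 - 4 * u) * t) = y at *
  generalize f (-((1 - 4 * u) * t)) = y' at *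
  have e : ∀ z, x * (x' * z) = z := fun z => by rw [← mul_assoc, h1, one_mul]
  have e' : ∀ z, y * (y' * z) = z := fun z => by rw [← mul_assoc, h2, one_mul]
  simp only [mul_assoc, e, e', h1]

/-- The five time fractions add up to `1`, while the leading errors add up to `(4 * u ^ m + (1 - 4 *
u) ^ m) • w`, which is zero by the choice of `u`. -/
theorem FlowApprox.suzukiStep {H : A} {m : ℕ} (hm : 1 ≤ m) (hodd : Odd m) {u : ℝ}
    (hu : 4 * u ^ m + (1 - 4 * u) ^ m = 0) {f : ℝ → A} {w : A} (h : FlowApprox H 1 m f w)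
    (hf : ∀ t, f t * f (-t) = 1) : ∃ w', FlowApprox H 1 (m + 2) (suzukiStep u f) w' := by
  refine FlowApprox.add_two_of_symm hodd ?_ (suzukiStep_symm hf)
  have h1 := h.scale u
  have h2 := h.scale (1 - 4 * u)
  have h3 := h1.mul hm (h1.mul hm (h2.mul hm (h1.mul hm h1)))
  have h4 : u + (u + (1 - 4 * u + (u + u))) = 1 := by ring
  have h5 : ((u : ℂ) ^ m) • w + (((u : ℂ) ^ m) • w + ((((1 - 4 * u : ℝ) : ℂ) ^ m) • w +
      (((u : ℂ) ^ m) • w + ((u : ℂ) ^ m) • w))) = 0 := by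
    have : (4 * (u : ℂ) ^ m + ((1 - 4 * u : ℝ) : ℂ) ^ m) = 0 := by exact_mod_cast hu
    rw [← zero_smul ℂ w, ← this]
    module
  rw [h4, h5] at h3
  exact h3

/-- The coefficient in Suzuki's recursion. -/
theorem exists_suzuki_coeff {m : ℕ} (hm : 2 ≤ m) (hodd : Odd m) :
    ∃ u : ℝ, |u| ≤ 1 ∧ |1 - 4 * u| ≤ 1 ∧ 4 * u ^ m + (1 - 4 * u) ^ m = 0 := by
  -- For odd `m` the equation is `4 * u - 1 = c * u`, hence `u = 1 / (4 - c)`. As `c ≤ 2` for `m ≥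
  -- 2`, both coefficients lie in `[-1, 1]`.
  set c : ℝ := (4 : ℝ) ^ (1 / (m : ℝ)) with hc
  have hm0 : m ≠ 0 := by omega
  have hcm : c ^ m = 4 := by
    rw [hc, one_div]; exact Real.rpow_inv_natCast_pow (by norm_num) hm0
  have hc0 : 0 < c := Real.rpow_pos_of_pos (by norm_num) _
  have hc2 : c ≤ 2 := by
    by_contra hlt
    push Not at hlt
    have h1 : (2 : ℝ) ^ m < c ^ m := pow_lt_pow_left₀ hlt (by norm_num) hm0
    have h2 : (2 : ℝ) ^ 2 ≤ 2 ^ m := pow_le_pow_right₀ (by norm_num) hm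
    rw [hcm] at h1
    linarith
  have h4c : 0 < 4 - c := by linarith
  have h14 : 1 - 4 * (1 / (4 - c)) = -(c * (1 / (4 - c))) := by field_simp; ring
  refine ⟨1 / (4 - c), ?_, ?_, ?_⟩
  · rw [abs_of_pos (by positivity), div_le_one h4c]; linarith
  · rw [h14, abs_neg, abs_of_pos (by positivity), mul_one_div, div_le_one h4c]; linarith
  · rw [h14, hodd.neg_pow, mul_pow, hcm]; ring

theorem flowApprox_one_flow (X : A) : FlowApprox (0 : A) 1 1 (flow X) X := by
  obtain ⟨h, hh, he⟩ := exists_eq_smul_of_analyticAt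
    ((analyticAt_flow X 0).sub analyticAt_const) (g := fun t => flow X t - 1) (by simp)
  refine ⟨h, hh, ?_, fun t => ?_⟩
  · have h1 := (Complex.ofRealCLM.hasDerivAt (x := (0 : ℝ))).smul
      hh.differentiableAt.hasDerivAt
    have h2 := (hasDerivAt_flow X 0).sub_const 1
    have h3 : (fun t => flow X t - 1) = (fun t : ℝ => Complex.ofRealCLM t • h t) := funext he
    have h2' : HasDerivAt (fun t : ℝ => Complex.ofRealCLM t • h t) (X * flow X 0) 0 := by
      rw [← h3]; exact h2
    have := h1.unique h2'
    simpa using this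
  · have := he t
    have h0 : flow (0 : A) (1 * t) = 1 := by simp [flow]
    rw [h0, pow_one, ← this]; abel

end SymmetricComposition

/-! ### Reversal and consistency of products of flows. -/

section ListsOfFlows

variable {A : Type*} [CStarAlgebra A]

theorem flowProd_append (L₁ L₂ : List A) (t : ℝ) :
    flowProd (L₁ ++ L₂) t = flowProd L₁ t * flowProd L₂ t := by
  simp [flowProd]

theorem flowProd_mul_flowProd_reverse_neg (L : List A) (t : ℝ) :
    flowProd L t * flowProd L.reverse (-t) = 1 := by
  induction L with
  | nil => simp [flowProd]
  | cons B L ih =>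
    have h1 : flowProd (B :: L) t = flow B t * flowProd L t := by simp [flowProd]
    have h2 : flowProd [B] (-t) = flow B (-t) := by simp [flowProd]
    rw [List.reverse_cons, flowProd_append, h1, h2, ← mul_assoc, mul_assoc (flow B t), ih, mul_one,
      flow_mul_flow_neg]

theorem flowApprox_zero_flowProd (L : List A) : FlowApprox (0 : A) 1 1 (flowProd L) L.sum := by
  -- The flow of `0` is constant, so the time factor `1 + 1` produced by `FlowApprox.mul` can be
  -- reset to `1`.
  have hzero : ∀ {a b : ℝ} {f : ℝ → A} {w : A}, FlowApprox (0 : A) a 1 f w →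
      FlowApprox (0 : A) b 1 f w := by
    rintro a b f w ⟨g, hg, hw, he⟩
    exact ⟨g, hg, hw, fun t => by rw [he]; simp [flow]⟩
  induction L with
  | nil => exact ⟨fun _ => 0, analyticAt_const, by simp, fun t => by simp [flowProd, flow]⟩
  | cons B L ih =>
    have h := (flowApprox_one_flow B).mul le_rfl ih
    have h1 : flowProd (B :: L) = fun t => flow B t * flowProd L t := by
      ext t; simp [flowProd]
    rw [h1, List.sum_cons]
    exact hzero h

/-- A product of flows is consistent with the flow of the sum of the generators. -/
theorem flowApprox_flowProd (L : List A) : FlowApprox L.sum 1 1 (flowProd L) 0 := by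
  obtain ⟨g, hg, hw, he⟩ := flowApprox_zero_flowProd L
  obtain ⟨g', hg', hw', he'⟩ := flowApprox_one_flow L.sum
  refine ⟨fun t => g t - g' t, hg.sub hg', by simp [hw, hw'], fun t => ?_⟩
  rw [he, one_mul (a := t), he', one_mul, smul_sub]
  abel

theorem commSum_mono (q : ℕ) (L : List A) {φ ψ : Seminorm ℂ A} (h : ∀ X, φ X ≤ ψ X) :
    commSum q L φ ≤ commSum q L ψ := by
  induction q generalizing φ ψ with
  | zero => exact List.sum_le_sum fun X _ => h X
  | succ q ih => exact List.sum_le_sum fun X _ => ih fun Y => h _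

theorem commSum_comp_adLin_smul_le (q : ℕ) (L : List A) (φ : Seminorm ℂ A) {a : ℝ} (ha : |a| ≤ 1)
    (X : A) : commSum q L (φ.comp (adLin ((a : ℂ) • X))) ≤ commSum q L (φ.comp (adLin X)) := by
  refine commSum_mono q L fun Y => ?_
  have h1 : adLin ((a : ℂ) • X) Y = (a : ℂ) • adLin X Y := by
    simp [smul_sub]
  rw [Seminorm.comp_apply, Seminorm.comp_apply, h1, map_smul_eq_mul, Complex.norm_real]
  exact mul_le_of_le_one_left (apply_nonneg φ _) ha

end ListsOfFlows

/-! ### Product formulas as lists of flows, and the Suzuki formulas. -/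

namespace ProductFormula

variable {Υ Υ' Γ : ℕ} {d : Type*} [Fintype d] [DecidableEq d]

/-- The generators of the exponentials in a product formula, the last one being applied first. -/
def steps (F : ProductFormula Υ Γ) (X : Fin Γ → Matrix d d ℂ) : List (Matrix d d ℂ) :=
  ((List.ofFn fun υ : Fin Υ =>
    (List.ofFn fun γ : Fin Γ => ((F.coeff υ γ : ℝ) : ℂ) • X (F.perm υ γ)).reverse).reverse).flatten

theorem eval_eq_flowProd (F : ProductFormula Υ Γ) (X : Fin Γ → Matrix d d ℂ) (t : ℝ) :
    F.eval X t = flowProd (F.steps X) t := by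
  simp only [eval, steps, flowProd, List.map_flatten, List.prod_flatten, List.map_reverse,
    List.map_ofFn]
  congr 3
  ext υ : 1
  simp only [Function.comp_apply, List.map_reverse, List.map_ofFn]
  congr 3
  ext γ : 1
  simp only [Function.comp_apply, flow, smul_smul]
  push_cast
  rfl

theorem sum_map_steps {M e : Type*} [AddCommMonoid M] (F : ProductFormula Υ Γ)
    (X : Fin Γ → Matrix e e ℂ) (g : Matrix e e ℂ → M) :
    ((F.steps X).map g).sum = ∑ υ, ∑ γ, g (((F.coeff υ γ : ℝ) : ℂ) • X (F.perm υ γ)) := by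
  simp only [steps, List.map_flatten, List.sum_flatten, List.map_reverse, List.map_ofFn,
    List.sum_reverse, List.sum_ofFn, Function.comp_apply]

theorem mem_skewAdjoint_of_mem_steps (F : ProductFormula Υ Γ) {X : Fin Γ → Matrix d d ℂ}
    (hX : ∀ γ, X γ ∈ skewAdjoint (Matrix d d ℂ)) :
    ∀ B ∈ F.steps X, B ∈ skewAdjoint (Matrix d d ℂ) := by
  intro B hB
  simp only [steps, List.mem_flatten, List.mem_reverse, List.mem_ofFn] at hB
  obtain ⟨_, ⟨υ, rfl⟩, hB⟩ := hB
  simp only [List.mem_reverse, List.mem_ofFn] at hB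
  obtain ⟨γ, rfl⟩ := hB
  have := hX (F.perm υ γ)
  rw [skewAdjoint.mem_iff] at this ⊢
  rw [star_smul, this]
  simp

theorem sum_map_steps_le {e : Type*} (F : ProductFormula Υ Γ) (X : Fin Γ → Matrix e e ℂ)
    (g : Matrix e e ℂ → ℝ) (hg : ∀ (a : ℝ) Y, |a| ≤ 1 → g ((a : ℂ) • Y) ≤ g Y) :
    ((F.steps X).map g).sum ≤ Υ * ∑ γ, g (X γ) := by
  rw [sum_map_steps]
  calc _ ≤ ∑ _υ : Fin Υ, ∑ γ, g (X γ) := by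
        refine Finset.sum_le_sum fun υ _ => ?_
        exact (Finset.sum_le_sum fun γ _ => hg _ _ (F.abs_coeff_le_one υ γ)).trans_eq
          (Equiv.sum_comp (F.perm υ) fun γ => g (X γ))
    _ = _ := by simp

/-- Every summand occurs once per stage with a coefficient of modulus at most `1`, so each of the `q
+ 1` slots of the commutator costs a factor `Υ`. -/
theorem commSum_steps_le (F : ProductFormula Υ Γ) (X : Fin Γ → Matrix d d ℂ) (q : ℕ)
    (φ : Seminorm ℂ (Matrix d d ℂ)) :
    commSum q (F.steps X) φ ≤
      (Υ : ℝ) ^ (q + 1) * ∑ f : Fin (q + 1) → Fin Γ, φ (nestedCommutator q fun i => X (f i)) := by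
  induction q generalizing φ with
  | zero =>
    have h := F.sum_map_steps_le X φ fun a Y ha => by
      rw [map_smul_eq_mul, Complex.norm_real]
      exact mul_le_of_le_one_left (apply_nonneg φ _) ha
    have h1 : ∑ f : Fin 1 → Fin Γ, φ (nestedCommutator 0 fun i => X (f i)) = ∑ γ, φ (X γ) :=
      Fintype.sum_equiv (Equiv.funUnique (Fin 1) (Fin Γ)) _ _ fun f => rfl
    rw [h1]
    simpa [commSum] using h
  | succ q ih =>
    have h := F.sum_map_steps_le X (fun B => commSum q (F.steps X) (φ.comp (adLin B)))
      fun a Y ha => commSum_comp_adLin_smul_le q _ φ ha Y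
    refine h.trans ?_
    rw [pow_succ', mul_assoc]
    refine mul_le_mul_of_nonneg_left ?_ (Nat.cast_nonneg Υ)
    refine (Finset.sum_le_sum fun γ _ => ih (φ.comp (adLin (X γ)))).trans_eq ?_
    rw [← Finset.mul_sum, ← (Fin.snocEquiv fun _ : Fin (q + 2) => Fin Γ).sum_comp,
      Fintype.sum_prod_type]
    congr 1
    refine Finset.sum_congr rfl fun γ _ => Finset.sum_congr rfl fun f _ => ?_
    rw [Seminorm.comp_apply, nestedCommutator, Ring.lie_def]
    simp [Fin.snocEquiv]

/-- The product formula that applies `F` and then `G`. -/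
def append (F : ProductFormula Υ Γ) (G : ProductFormula Υ' Γ) : ProductFormula (Υ + Υ') Γ where
  coeff := Fin.append F.coeff G.coeff
  perm := Fin.append F.perm G.perm
  abs_coeff_le_one υ γ := by
    refine Fin.addCases (fun i => ?_) (fun i => ?_) υ
    · simpa using F.abs_coeff_le_one i γ
    · simpa using G.abs_coeff_le_one i γ

theorem eval_append (F : ProductFormula Υ Γ) (G : ProductFormula Υ' Γ) (X : Fin Γ → Matrix d d ℂ)
    (t : ℝ) : (F.append G).eval X t = G.eval X t * F.eval X t := by
  have h : ∀ (hle : Υ ≤ Υ + Υ') (i : Fin Υ), Fin.castLE hle i = Fin.castAdd Υ' i :=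
    fun _ _ => rfl
  simp only [eval, List.ofFn_add, append, h, Fin.append_left, Fin.append_right, List.reverse_append,
    List.prod_append]

/-- The product formula with all coefficients multiplied by `u`. -/
def scale (F : ProductFormula Υ Γ) (u : ℝ) (hu : |u| ≤ 1) : ProductFormula Υ Γ where
  coeff υ γ := u * F.coeff υ γ
  perm := F.perm
  abs_coeff_le_one υ γ := by
    rw [abs_mul]
    exact mul_le_one₀ hu (abs_nonneg _) (F.abs_coeff_le_one υ γ)

theorem eval_scale (F : ProductFormula Υ Γ) (u : ℝ) (hu : |u| ≤ 1) (X : Fin Γ → Matrix d d ℂ)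
    (t : ℝ) : (F.scale u hu).eval X t = F.eval X (u * t) := by
  have : ∀ c : ℝ, t * (u * c) = u * t * c := fun c => by ring
  simp only [eval, scale, this]

theorem isOrder_of_flowApprox {F : ProductFormula Υ Γ} {X : Fin Γ → Matrix d d ℂ} {p : ℕ}
    {w : Matrix d d ℂ} (h : FlowApprox (∑ γ, X γ) 1 (p + 1) (F.eval X) w) : F.IsOrder p X :=
  h.isBigO

/-- The second-order Suzuki formula. -/
def strang (Γ : ℕ) : ProductFormula 2 Γ where
  coeff _ _ := 1 / 2
  perm := ![Equiv.refl _, Fin.revPerm]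
  abs_coeff_le_one _ _ := by rw [abs_of_pos] <;> norm_num

theorem reverse_ofFn_rev {α : Type*} {m : ℕ} (f : Fin m → α) :
    (List.ofFn fun i : Fin m => f i.rev).reverse = List.ofFn f := by
  apply List.ext_getElem
  · simp
  · intro i h1 h2
    simp only [List.length_ofFn] at h2
    simp only [List.getElem_reverse, List.getElem_ofFn, List.length_ofFn]
    congr 1
    ext
    simp only [Fin.val_rev]
    omega

theorem steps_strang {e : Type*} (X : Fin Γ → Matrix e e ℂ) :
    (strang Γ).steps X = List.ofFn (fun γ => (((1 / 2 : ℝ)) : ℂ) • X γ) ++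
      (List.ofFn fun γ => (((1 / 2 : ℝ)) : ℂ) • X γ).reverse := by
  simpa [steps, strang, List.ofFn_succ] using reverse_ofFn_rev fun γ => (2⁻¹ : ℂ) • X γ

/-- The list of steps is a palindrome, and the reversed list run backwards in time is the inverse.
-/
theorem eval_strang_symm (X : Fin Γ → Matrix d d ℂ) (t : ℝ) :
    (strang Γ).eval X t * (strang Γ).eval X (-t) = 1 := by
  have h : ((strang Γ).steps X).reverse = (strang Γ).steps X := by
    rw [steps_strang, List.reverse_append, List.reverse_reverse]
  rw [eval_eq_flowProd, eval_eq_flowProd]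
  nth_rewrite 2 [← h]
  exact flowProd_mul_flowProd_reverse_neg _ _

theorem flowApprox_eval_strang (X : Fin Γ → Matrix d d ℂ) :
    ∃ w, FlowApprox (∑ γ, X γ) 1 3 ((strang Γ).eval X) w := by
  have hsum : ((strang Γ).steps X).sum = ∑ γ, X γ := by
    have := (strang Γ).sum_map_steps X id
    rw [List.map_id] at this
    rw [this, Fin.sum_univ_two]
    simp only [strang, id, Matrix.cons_val_zero, Matrix.cons_val_one, Equiv.refl_apply,
      ← Finset.smul_sum, Equiv.sum_comp]
    rw [← add_smul]
    norm_num
  have h := flowApprox_flowProd ((strang Γ).steps X)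
  have he : flowProd ((strang Γ).steps X) = (strang Γ).eval X := by
    ext1 t; rw [eval_eq_flowProd]
  rw [hsum, he] at h
  exact h.add_two_of_symm odd_one (eval_strang_symm X)

/-- Suzuki's product formulas of every even order, with coefficients in `[-1, 1]`. -/
theorem exists_suzuki_formula (κ : ℕ) : ∃ Υ : ℕ, ∀ Γ : ℕ, ∃ F : ProductFormula Υ Γ,
    ∀ (n : ℕ) (X : Fin Γ → QOp n), (∀ t, F.eval X t * F.eval X (-t) = 1) ∧
      ∃ w, FlowApprox (∑ γ, X γ) 1 (2 * κ + 3) (F.eval X) w := by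
  induction κ with
  | zero => exact ⟨2, fun Γ => ⟨strang Γ, fun n X =>
      ⟨eval_strang_symm X, flowApprox_eval_strang X⟩⟩⟩
  | succ κ ih =>
    obtain ⟨Υ, hΥ⟩ := ih
    have hodd : Odd (2 * κ + 3) := ⟨κ + 1, by ring⟩
    -- `u` depends on `κ` only, so the number of stages and the formula are fixed before `n` and `X`
    -- are given.
    obtain ⟨u, hu1, hu2, hu⟩ := exists_suzuki_coeff (by omega) hodd
    refine ⟨Υ + Υ + Υ + Υ + Υ, fun Γ => ?_⟩
    obtain ⟨F, hF⟩ := hΥ Γ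
    refine ⟨((((F.scale u hu1).append (F.scale u hu1)).append
      (F.scale (1 - 4 * u) hu2)).append (F.scale u hu1)).append (F.scale u hu1), fun n X => ?_⟩
    obtain ⟨hs, w, hw⟩ := hF n X
    have he : (((((F.scale u hu1).append (F.scale u hu1)).append
      (F.scale (1 - 4 * u) hu2)).append (F.scale u hu1)).append (F.scale u hu1)).eval X =
        suzukiStep u (F.eval X) := by
      ext1 t
      simp only [eval_append, eval_scale, suzukiStep]
    rw [he]
    exact ⟨suzukiStep_symm hs, hw.suzukiStep (by omega) hodd hu hs⟩

end ProductFormula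

/-! ### Trotter error in terms of `alphaComm`. -/

namespace LocalHamiltonian

variable {n k : ℕ}

theorem generator_mem_skewAdjoint (H : LocalHamiltonian n k) (γ : Fin (n ^ k)) :
    H.generator γ ∈ skewAdjoint (QOp n) := by
  have h : star (H.summand γ) = H.summand γ := H.isHermitian _
  rw [skewAdjoint.mem_iff, generator, star_smul, h]
  simp

theorem sum_generator (H : LocalHamiltonian n k) :
    ∑ γ, H.generator γ = (-Complex.I) • H.toOp := by
  simp only [generator, summand, toOp, ← Finset.smul_sum]
  congr 1
  exact Equiv.sum_comp (finFunctionFinEquiv (m := n) (n := k)).symm H.term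

theorem evolution_eq_flow (H : LocalHamiltonian n k) (t : ℝ) :
    H.evolution t = flow (∑ γ, H.generator γ) t := by
  rw [sum_generator, evolution, flow, smul_smul]
  congr 2
  ring

theorem sum_generator_mem_skewAdjoint (H : LocalHamiltonian n k) :
    ∑ γ, H.generator γ ∈ skewAdjoint (QOp n) :=
  sum_mem fun γ _ => H.generator_mem_skewAdjoint γ

theorem nestedCommutator_smul {d : Type*} [Fintype d] [DecidableEq d] (c : ℂ) (q : ℕ)
    (X : Fin (q + 1) → Matrix d d ℂ) :
    nestedCommutator q (fun i => c • X i) = c ^ (q + 1) • nestedCommutator q X := by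
  induction q with
  | zero => simp [nestedCommutator]
  | succ q ih =>
    rw [nestedCommutator, nestedCommutator, ih]
    simp only [Ring.lie_def, smul_mul_smul_comm, smul_sub, ← pow_succ, ← pow_succ']

theorem norm_trotterStep_sub_evolution_le {Υ p : ℕ} (hp : 1 ≤ p) (H : LocalHamiltonian n k)
    (F : ProductFormula Υ (n ^ k)) (hF : F.IsOrder p H.generator) {t : ℝ} (ht : 0 ≤ t) :
    ‖H.trotterStep F t - H.evolution t‖ ≤ (Υ : ℝ) ^ (p + 1) * H.alphaComm p * t ^ (p + 1) := by
  have hord : (fun t : ℝ => flowProd (F.steps H.generator) t - flow (∑ γ, H.generator γ) t) =O[𝓝 0]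
      fun t : ℝ => t ^ (p + 1) := by
    simp only [← ProductFormula.eval_eq_flowProd]
    exact hF
  have h1 := norm_flowProd_sub_flow_le H.sum_generator_mem_skewAdjoint
    (F.mem_skewAdjoint_of_mem_steps H.generator_mem_skewAdjoint) hp hord ht
  have h2 := F.commSum_steps_le H.generator p (normSeminorm ℂ (QOp n))
  have h3 : ∑ f : Fin (p + 1) → Fin (n ^ k),
      (normSeminorm ℂ (QOp n)) (nestedCommutator p fun i => H.generator (f i)) =
        H.alphaComm p := by
    refine Finset.sum_congr rfl fun f _ => ?_
    have := nestedCommutator_smul (-Complex.I) p fun i => H.summand (f i)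
    simp only [generator, coe_normSeminorm]
    rw [this, norm_smul]
    simp
  rw [h3] at h2
  rw [evolution_eq_flow, trotterStep, ProductFormula.eval_eq_flowProd]
  exact h1.trans (mul_le_mul_of_nonneg_right h2 (pow_nonneg ht _))

theorem trotterStep_mem_unitary {Υ : ℕ} (H : LocalHamiltonian n k) (F : ProductFormula Υ (n ^ k))
    (t : ℝ) : H.trotterStep F t ∈ unitary (QOp n) := by
  rw [trotterStep, ProductFormula.eval_eq_flowProd]
  exact flowProd_mem_unitary (F.mem_skewAdjoint_of_mem_steps H.generator_mem_skewAdjoint) t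

end LocalHamiltonian

/-! ### Operators supported on few qubits. -/

section Locality

open scoped Kronecker

variable {n : ℕ}

/-- The embedding `B ↦ B ⊗ 1` of the operators on the qubits in `S`. -/
def localHom (S : Finset (Fin n)) : Matrix (S → Fin 2) (S → Fin 2) ℂ →+* QOp n where
  toFun B := (B ⊗ₖ (1 : Matrix ({i // i ∉ S} → Fin 2) ({i // i ∉ S} → Fin 2) ℂ)).submatrix
    (Equiv.piEquivPiSubtypeProd (· ∈ S) fun _ => Fin 2)
    (Equiv.piEquivPiSubtypeProd (· ∈ S) fun _ => Fin 2)
  map_one' := by rw [Matrix.one_kronecker_one, Matrix.submatrix_one_equiv]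
  map_mul' B C := by
    rw [Matrix.submatrix_mul_equiv, ← Matrix.mul_kronecker_mul, one_mul]
  map_zero' := by simp
  map_add' B C := by rw [Matrix.add_kronecker]; rfl

theorem localHom_apply (S : Finset (Fin n)) (B : Matrix (S → Fin 2) (S → Fin 2) ℂ)
    (x y : Fin n → Fin 2) : localHom S B x y =
      B (fun i => x i) (fun i => y i) * if ∀ i, i ∉ S → x i = y i then 1 else 0 := by
  change B _ _ * (1 : Matrix ({i // i ∉ S} → Fin 2) ({i // i ∉ S} → Fin 2) ℂ) _ _ = _
  rw [Matrix.one_apply]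
  congr 2
  simp [funext_iff]

theorem localHom_smul (S : Finset (Fin n)) (c : ℂ) (B : Matrix (S → Fin 2) (S → Fin 2) ℂ) :
    localHom S (c • B) = c • localHom S B := by
  ext x y
  simp [localHom_apply]

theorem localHom_injective (S : Finset (Fin n)) : Function.Injective (localHom S) := by
  intro B C h
  ext u v
  have h1 := congrFun (congrFun h fun i => if hi : i ∈ S then u ⟨i, hi⟩ else 0)
    fun i => if hi : i ∈ S then v ⟨i, hi⟩ else 0
  rw [localHom_apply, localHom_apply, if_pos] at h1
  · simpa using h1
  · intro i hi; simp [hi]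

theorem actsOnlyOn_iff_exists_localHom {A : QOp n} {S : Finset (Fin n)} :
    ActsOnlyOn A S ↔ ∃ B, localHom S B = A := by
  refine exists_congr fun B => ⟨fun h => ?_, ?_⟩
  · ext x y
    rw [localHom_apply]
    split_ifs with hxy
    · rw [(h x y).1 hxy, mul_one]
    · rw [(h x y).2 hxy, mul_zero]
  · rintro rfl x y
    rw [localHom_apply]
    constructor <;> intro hxy
    · rw [if_pos hxy, mul_one]
    · rw [if_neg hxy, mul_zero]

/-- An operator acts only on `S` if and only if it preserves the bits outside `S` and its entries
do not depend on them. -/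
theorem actsOnlyOn_iff {A : QOp n} {S : Finset (Fin n)} :
    ActsOnlyOn A S ↔ (∀ x y, ¬ (∀ i, i ∉ S → x i = y i) → A x y = 0) ∧
      ∀ x y x' y', (∀ i, i ∉ S → x i = y i) → (∀ i, i ∉ S → x' i = y' i) →
        (∀ i ∈ S, x i = x' i) → (∀ i ∈ S, y i = y' i) → A x y = A x' y' := by
  constructor
  · rintro ⟨B, hB⟩
    refine ⟨fun x y => (hB x y).2, fun x y x' y' h h' hx hy => ?_⟩
    rw [(hB x y).1 h, (hB x' y').1 h']
    congr 1
    · ext i : 1; exact hx i i.2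
    · ext i : 1; exact hy i i.2
  · rintro ⟨h0, h1⟩
    refine ⟨fun u v => A (fun i => if hi : i ∈ S then u ⟨i, hi⟩ else 0)
      (fun i => if hi : i ∈ S then v ⟨i, hi⟩ else 0), fun x y => ⟨fun h => ?_, h0 x y⟩⟩
    refine h1 _ _ _ _ h ?_ ?_ ?_
    · intro i hi; simp [hi]
    · intro i hi; simp [hi]
    · intro i hi; simp [hi]

theorem ActsOnlyOn.mono {A : QOp n} {S T : Finset (Fin n)} (h : ActsOnlyOn A S) (hST : S ⊆ T) :
    ActsOnlyOn A T := by
  rw [actsOnlyOn_iff] at h ⊢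
  obtain ⟨h0, h1⟩ := h
  refine ⟨fun x y hxy => h0 x y fun h => hxy fun i hi => h i fun hS => hi (hST hS), ?_⟩
  intro x y x' y' h h' hx hy
  by_cases hxy : ∀ i, i ∉ S → x i = y i
  · refine h1 x y x' y' hxy (fun i hi => ?_) (fun i hi => hx i (hST hi)) fun i hi => hy i (hST hi)
    by_cases hT : i ∈ T
    · rw [← hx i hT, ← hy i hT]; exact hxy i hi
    · exact h' i hT
  · rw [h0 x y hxy, h0 x' y' fun hxy' => hxy fun i hi => ?_]
    by_cases hT : i ∈ T
    · rw [hx i hT, hy i hT]; exact hxy' i hi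
    · exact h i hT

theorem ActsOnlyOn.mul {A B : QOp n} {S : Finset (Fin n)} (hA : ActsOnlyOn A S)
    (hB : ActsOnlyOn B S) : ActsOnlyOn (A * B) S := by
  rw [actsOnlyOn_iff_exists_localHom] at *
  obtain ⟨A, rfl⟩ := hA
  obtain ⟨B, rfl⟩ := hB
  exact ⟨A * B, map_mul _ _ _⟩

theorem ActsOnlyOn.sub {A B : QOp n} {S : Finset (Fin n)} (hA : ActsOnlyOn A S)
    (hB : ActsOnlyOn B S) : ActsOnlyOn (A - B) S := by
  rw [actsOnlyOn_iff_exists_localHom] at *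
  obtain ⟨A, rfl⟩ := hA
  obtain ⟨B, rfl⟩ := hB
  exact ⟨A - B, map_sub _ _ _⟩

theorem ActsOnlyOn.add {A B : QOp n} {S : Finset (Fin n)} (hA : ActsOnlyOn A S)
    (hB : ActsOnlyOn B S) : ActsOnlyOn (A + B) S := by
  rw [actsOnlyOn_iff_exists_localHom] at *
  obtain ⟨A, rfl⟩ := hA
  obtain ⟨B, rfl⟩ := hB
  exact ⟨A + B, map_add _ _ _⟩

theorem ActsOnlyOn.smul {A : QOp n} {S : Finset (Fin n)} (c : ℂ) (hA : ActsOnlyOn A S) :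
    ActsOnlyOn (c • A) S := by
  rw [actsOnlyOn_iff_exists_localHom] at *
  obtain ⟨A, rfl⟩ := hA
  exact ⟨c • A, localHom_smul _ _ _⟩

theorem actsOnlyOn_one (S : Finset (Fin n)) : ActsOnlyOn (1 : QOp n) S :=
  actsOnlyOn_iff_exists_localHom.2 ⟨1, map_one _⟩

/-- A matrix product whose only contribution comes from the bit string that agrees with `y` on `S`
and with `x` elsewhere. -/
theorem ActsOnlyOn.mul_apply {A B : QOp n} {S T : Finset (Fin n)} (hA : ActsOnlyOn A S)
    (hB : ActsOnlyOn B T) (hST : Disjoint S T) (x y : Fin n → Fin 2) :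
    (A * B) x y = A x (S.piecewise y x) * B (S.piecewise y x) y := by
  rw [Matrix.mul_apply]
  refine Finset.sum_eq_single _ (fun z _ hz => ?_) (by simp)
  rw [actsOnlyOn_iff] at hA hB
  by_cases h1 : ∀ i, i ∉ S → x i = z i
  · by_cases h2 : ∀ i, i ∉ T → z i = y i
    · refine absurd ?_ hz
      ext i : 1
      by_cases hi : i ∈ S
      · rw [Finset.piecewise_eq_of_mem _ _ _ hi]
        exact h2 i (Finset.disjoint_left.1 hST hi)
      · rw [Finset.piecewise_eq_of_notMem _ _ _ hi, h1 i hi]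
    · rw [hB.1 z y h2, mul_zero]
  · rw [hA.1 x z h1, zero_mul]

/-- Each product has only one path from `x` to `y`, changing the bits of `S` first or those of `T`
first. The entries along both paths agree, as an entry of `A` does not see the bits of `T` and
conversely. If `x` and `y` differ outside `S ∪ T`, both products vanish. -/
theorem ActsOnlyOn.commute {A B : QOp n} {S T : Finset (Fin n)} (hA : ActsOnlyOn A S)
    (hB : ActsOnlyOn B T) (hST : Disjoint S T) : A * B = B * A := by
  ext x y
  rw [hA.mul_apply hB hST, hB.mul_apply hA hST.symm]
  rw [actsOnlyOn_iff] at hA hB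
  have hdis : ∀ i, i ∈ S → i ∉ T := fun _ hi => Finset.disjoint_left.1 hST hi
  by_cases h : ∀ i, i ∉ S → i ∉ T → x i = y i
  · rw [mul_comm]
    congr 1
    · refine hB.2 _ _ _ _ ?_ ?_ ?_ ?_ <;> intro i hi <;> simp only [Finset.piecewise] <;> grind
    · refine hA.2 _ _ _ _ ?_ ?_ ?_ ?_ <;> intro i hi <;> simp only [Finset.piecewise] <;> grind
  · rw [hB.1 (S.piecewise y x) y, hA.1 (T.piecewise y x) y, mul_zero, mul_zero]
    · intro h'
      refine h fun i hS hT => ?_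
      have := h' i hS
      rwa [Finset.piecewise_eq_of_notMem _ _ _ hT] at this
    · intro h'
      refine h fun i hS hT => ?_
      have := h' i hT
      rwa [Finset.piecewise_eq_of_notMem _ _ _ hS] at this

end Locality

/-! ### Commutator scaling of local Hamiltonians. -/

namespace LocalHamiltonian

variable {n k : ℕ}

/-- The qubits on which the summands `H_γ` with `γ` in the range of `f` act. -/
def supportOf {q : ℕ} (f : Fin q → Fin (n ^ k)) : Finset (Fin n) :=
  Finset.univ.biUnion fun i => Finset.univ.image (finFunctionFinEquiv.symm (f i))

theorem card_supportOf_le {q : ℕ} (f : Fin q → Fin (n ^ k)) : (supportOf f).card ≤ q * k := by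
  refine Finset.card_biUnion_le.trans ((Finset.sum_le_card_nsmul _ _ k fun i _ => ?_).trans ?_)
  · exact Finset.card_image_le.trans (by simp)
  · simp

theorem nestedCommutator_actsOnlyOn (H : LocalHamiltonian n k) (q : ℕ)
    (f : Fin (q + 1) → Fin (n ^ k)) :
    ActsOnlyOn (nestedCommutator q fun i => H.summand (f i)) (supportOf f) := by
  induction q with
  | zero =>
    refine (H.support _).mono ?_
    exact Finset.subset_biUnion_of_mem
      (fun i => Finset.univ.image (finFunctionFinEquiv.symm (f i))) (Finset.mem_univ 0)
  | succ q ih =>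
    have h1 : ActsOnlyOn (H.summand (f (Fin.last (q + 1)))) (supportOf f) :=
      (H.support _).mono (Finset.subset_biUnion_of_mem
        (fun i => Finset.univ.image (finFunctionFinEquiv.symm (f i))) (Finset.mem_univ _))
    have h2 : ActsOnlyOn (nestedCommutator q fun i => H.summand (f i.castSucc)) (supportOf f) := by
      refine (ih fun i => f i.castSucc).mono (Finset.biUnion_subset.2 fun i _ => ?_)
      exact Finset.subset_biUnion_of_mem
        (fun i => Finset.univ.image (finFunctionFinEquiv.symm (f i))) (Finset.mem_univ i.castSucc)
    rw [nestedCommutator, Ring.lie_def]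
    exact (h1.mul h2).sub (h2.mul h1)

theorem sum_norm_le_inducedOneNorm (H : LocalHamiltonian n k) (l : Fin k) (i : Fin n) :
    ∑ j : Fin k → Fin n with j l = i, ‖H.term j‖ ≤ H.inducedOneNorm := by
  refine le_trans ?_ (le_ciSup (Set.finite_range _).bddAbove l)
  exact le_ciSup (f := fun i : Fin n => ∑ j : Fin k → Fin n with j l = i, ‖H.term j‖)
    (Set.finite_range _).bddAbove i

theorem inducedOneNorm_nonneg (H : LocalHamiltonian n k) : 0 ≤ H.inducedOneNorm :=
  Real.iSup_nonneg fun _ => Real.iSup_nonneg fun _ => Finset.sum_nonneg fun _ _ => norm_nonneg _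

theorem oneNorm_nonneg (H : LocalHamiltonian n k) : 0 ≤ H.oneNorm :=
  Finset.sum_nonneg fun _ _ => norm_nonneg _

theorem inducedOneNorm_le_oneNorm (H : LocalHamiltonian n k) : H.inducedOneNorm ≤ H.oneNorm :=
  Real.iSup_le (fun _ => Real.iSup_le (fun _ =>
    Finset.sum_le_sum_of_subset_of_nonneg (Finset.filter_subset _ _) fun _ _ _ => norm_nonneg _)
    H.oneNorm_nonneg) H.oneNorm_nonneg

/-- Commutators with an operator on few qubits are controlled by the induced `1`-norm. -/
theorem sum_norm_lie_le (H : LocalHamiltonian n k) {Y : QOp n} {T : Finset (Fin n)}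
    (hY : ActsOnlyOn Y T) :
    ∑ γ, ‖⁅H.summand γ, Y⁆‖ ≤ 2 * (k * T.card * H.inducedOneNorm) * ‖Y‖ := by
  -- A term that does not commute with `Y` has some `j l ∈ T`. Summing over all pairs `(l, i)` with
  -- `i ∈ T` may overcount, but each pair contributes at most the induced norm.
  have h1 : ∀ j, ‖⁅H.term j, Y⁆‖ ≤
      2 * ‖Y‖ * ∑ l : Fin k, ∑ i ∈ T, if j l = i then ‖H.term j‖ else 0 := by
    intro j
    have hnn : ∀ l ∈ (Finset.univ : Finset (Fin k)),
        0 ≤ ∑ i ∈ T, if j l = i then ‖H.term j‖ else 0 := fun l _ =>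
      Finset.sum_nonneg fun i _ => by split_ifs <;> positivity
    rw [Ring.lie_def]
    by_cases hd : Disjoint (Finset.univ.image j) T
    · rw [(H.support j).commute hY hd, sub_self, norm_zero]
      exact mul_nonneg (by positivity) (Finset.sum_nonneg hnn)
    · obtain ⟨i, hi, hiT⟩ := Finset.not_disjoint_iff.1 hd
      obtain ⟨l, -, rfl⟩ := Finset.mem_image.1 hi
      have h2 : ‖H.term j‖ ≤ ∑ l : Fin k, ∑ i ∈ T, if j l = i then ‖H.term j‖ else 0 := by
        refine le_trans ?_ (Finset.single_le_sum hnn (Finset.mem_univ l))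
        rw [Finset.sum_ite_eq, if_pos hiT]
      calc _ ≤ ‖H.term j * Y‖ + ‖Y * H.term j‖ := norm_sub_le _ _
        _ ≤ ‖H.term j‖ * ‖Y‖ + ‖Y‖ * ‖H.term j‖ := add_le_add (norm_mul_le _ _) (norm_mul_le _ _)
        _ = 2 * ‖Y‖ * ‖H.term j‖ := by ring
        _ ≤ _ := mul_le_mul_of_nonneg_left h2 (by positivity)
  have h2 : ∑ j, ∑ l : Fin k, ∑ i ∈ T, (if j l = i then ‖H.term j‖ else 0) ≤
      k * T.card * H.inducedOneNorm := by
    rw [Finset.sum_comm]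
    calc _ = ∑ l : Fin k, ∑ i ∈ T, ∑ j : Fin k → Fin n with j l = i, ‖H.term j‖ := by
          refine Finset.sum_congr rfl fun l _ => ?_
          rw [Finset.sum_comm]
          exact Finset.sum_congr rfl fun i _ => (Finset.sum_filter _ _).symm
      _ ≤ ∑ _l : Fin k, ∑ _i ∈ T, H.inducedOneNorm :=
          Finset.sum_le_sum fun l _ => Finset.sum_le_sum fun i _ =>
            H.sum_norm_le_inducedOneNorm l i
      _ = _ := by simp [mul_assoc]
  calc ∑ γ, ‖⁅H.summand γ, Y⁆‖ = ∑ j, ‖⁅H.term j, Y⁆‖ :=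
        Equiv.sum_comp (finFunctionFinEquiv (m := n) (n := k)).symm fun j => ‖⁅H.term j, Y⁆‖
    _ ≤ 2 * ‖Y‖ * ∑ j, ∑ l : Fin k, ∑ i ∈ T, (if j l = i then ‖H.term j‖ else 0) := by
        rw [Finset.mul_sum]; exact Finset.sum_le_sum fun j _ => h1 j
    _ ≤ 2 * ‖Y‖ * (k * T.card * H.inducedOneNorm) :=
        mul_le_mul_of_nonneg_left h2 (by positivity)
    _ = _ := by ring

/-- The constant in the bound on nested commutators of `k`-local summands. -/
def commConst (k : ℕ) : ℕ → ℝ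
  | 0 => 1
  | q + 1 => 2 * (k * ((q + 1 : ℕ) * k : ℕ)) * commConst k q

theorem commConst_nonneg (k q : ℕ) : 0 ≤ commConst k q := by
  induction q with
  | zero => exact zero_le_one
  | succ q ih => exact mul_nonneg (by positivity) ih

/-- The outermost commutator is peeled off: the inner one acts on at most `(q + 1) * k` qubits, so
summing over the outermost summand costs `2 * k * ((q + 1) * k)` times the induced norm. -/
theorem alphaComm_le (H : LocalHamiltonian n k) (p : ℕ) :
    H.alphaComm p ≤ commConst k p * (H.inducedOneNorm ^ p * H.oneNorm) := by
  induction p with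
  | zero =>
    refine le_of_eq ?_
    rw [commConst, pow_zero, one_mul, one_mul, alphaComm, oneNorm]
    rw [← Equiv.sum_comp (finFunctionFinEquiv (m := n) (n := k)).symm fun j => ‖H.term j‖]
    exact Fintype.sum_equiv (Equiv.funUnique (Fin 1) (Fin (n ^ k))) _ _ fun f => rfl
  | succ q ih =>
    have hI := H.inducedOneNorm_nonneg
    have h1 : H.alphaComm (q + 1) = ∑ f : Fin (q + 1) → Fin (n ^ k), ∑ γ,
        ‖⁅H.summand γ, nestedCommutator q fun i => H.summand (f i)⁆‖ := by
      rw [alphaComm, ← (Fin.snocEquiv fun _ : Fin (q + 2) => Fin (n ^ k)).sum_comp,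
        Fintype.sum_prod_type_right]
      refine Finset.sum_congr rfl fun f _ => Finset.sum_congr rfl fun γ _ => ?_
      rw [nestedCommutator]
      simp [Fin.snocEquiv]
    rw [h1]
    calc _ ≤ ∑ f : Fin (q + 1) → Fin (n ^ k),
          2 * (k * ((q + 1 : ℕ) * k : ℕ)) * H.inducedOneNorm *
            ‖nestedCommutator q fun i => H.summand (f i)‖ := by
          refine Finset.sum_le_sum fun f _ => ?_
          refine (H.sum_norm_lie_le (H.nestedCommutator_actsOnlyOn q f)).trans ?_
          have hc : ((supportOf f).card : ℝ) ≤ ((q + 1 : ℕ) * k : ℕ) := by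
            exact_mod_cast card_supportOf_le f
          rw [mul_assoc 2 _ H.inducedOneNorm]
          gcongr
      _ = 2 * (k * ((q + 1 : ℕ) * k : ℕ)) * H.inducedOneNorm * H.alphaComm q := by
          rw [← Finset.mul_sum]; rfl
      _ ≤ 2 * (k * ((q + 1 : ℕ) * k : ℕ)) * H.inducedOneNorm *
          (commConst k q * (H.inducedOneNorm ^ q * H.oneNorm)) :=
          mul_le_mul_of_nonneg_left ih (by positivity)
      _ = _ := by rw [commConst]; ring

end LocalHamiltonian

/-! ### Unitaries near the identity as products of rotations. -/

section Rotations

variable {A : Type*} [CStarAlgebra A]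

/-- The rotation `exp (i θ σ) = cos θ + i sin θ σ` generated by an involution `σ`. -/
def rot (σ : A) (θ : ℝ) : A := ((Real.cos θ : ℝ) : ℂ) • 1 + (((Real.sin θ : ℝ) : ℂ) * Complex.I) • σ

@[simp] theorem rot_zero (σ : A) : rot σ 0 = 1 := by simp [rot]

theorem rot_add {σ : A} (hσ : σ * σ = 1) (θ φ : ℝ) : rot σ (θ + φ) = rot σ θ * rot σ φ := by
  have hI : Complex.I * Complex.I = -1 := Complex.I_mul_I
  simp only [rot, Real.cos_add, Real.sin_add, mul_add, add_mul, smul_mul_smul_comm, hσ, one_mul,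
    mul_one]
  push_cast
  have h : ∀ a b : ℂ, a * Complex.I * (b * Complex.I) = -(a * b) := fun a b => by
    linear_combination a * b * hI
  rw [h]
  module

theorem rot_mul_rot_neg {σ : A} (hσ : σ * σ = 1) (θ : ℝ) : rot σ θ * rot σ (-θ) = 1 := by
  rw [← rot_add hσ]; simp

theorem star_rot {σ : A} (hs : star σ = σ) (θ : ℝ) : star (rot σ θ) = rot σ (-θ) := by
  simp [rot, star_add, star_smul, hs, -Complex.ofReal_cos, -Complex.ofReal_sin]

theorem rot_mem_unitary {σ : A} (hs : star σ = σ) (hσ : σ * σ = 1) (θ : ℝ) :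
    rot σ θ ∈ unitary A := by
  rw [Unitary.mem_iff, star_rot hs]
  refine ⟨?_, rot_mul_rot_neg hσ θ⟩
  simpa using rot_mul_rot_neg hσ (-θ)

theorem rot_conj {g g' : A} (hg : g * g' = 1) (σ : A) (θ : ℝ) :
    rot (g * σ * g') θ = g * rot σ θ * g' := by
  simp [rot, mul_add, add_mul, hg]

/-- Rotating an involution that anticommutes with the axis by a right angle. -/
theorem rot_mul_mul_rot_neg {a b : A} (ha : a * a = 1) (hab : a * b = -(b * a)) :
    rot a (Real.pi / 4) * b * rot a (-(Real.pi / 4)) = Complex.I • (a * b) := by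
  have h1 : b * rot a (-(Real.pi / 4)) = rot a (Real.pi / 4) * b := by
    simp only [rot, Real.cos_neg, Real.sin_neg, mul_add, add_mul, mul_smul_comm, smul_mul_assoc,
      mul_one, one_mul, hab]
    push_cast
    module
  rw [mul_assoc, h1, ← mul_assoc, ← rot_add ha]
  have h2 : Real.pi / 4 + Real.pi / 4 = Real.pi / 2 := by ring
  rw [h2]
  simp [rot]

theorem hasStrictDerivAt_rot (σ : A) : HasStrictDerivAt (rot σ) (Complex.I • σ) 0 := by
  have hc : HasStrictDerivAt (fun t : ℝ => ((Real.cos t : ℝ) : ℂ)) 0 0 := by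
    have := (Real.hasStrictDerivAt_cos 0)
    exact (Complex.ofRealCLM.hasStrictFDerivAt.comp_hasStrictDerivAt (0 : ℝ) this).congr_deriv
      (by simp)
  have hs : HasStrictDerivAt (fun t : ℝ => ((Real.sin t : ℝ) : ℂ) * Complex.I) Complex.I 0 := by
    have := (Real.hasStrictDerivAt_sin 0)
    exact ((Complex.ofRealCLM.hasStrictFDerivAt.comp_hasStrictDerivAt (0 : ℝ) this).mul_const
      Complex.I).congr_deriv (by simp)
  have h1 : HasStrictDerivAt (fun t : ℝ => ((Real.cos t : ℝ) : ℂ) • (1 : A)) ((0 : ℂ) • 1) 0 :=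
    hc.smul_const 1
  have h2 := hs.smul_const σ
  exact (h1.add h2).congr_deriv (by simp)

variable {ι : Type*}

/-- The product of the rotations with the angles `θ i` about the axes `b i`, for `i` in `l`. -/
def rotProd (b : ι → A) (l : List ι) (θ : ι → ℝ) : A := (l.map fun i => rot (b i) (θ i)).prod

theorem rotProd_mem_unitary {b : ι → A} (hs : ∀ i, star (b i) = b i) (hb : ∀ i, b i * b i = 1)
    (l : List ι) (θ : ι → ℝ) : rotProd b l θ ∈ unitary A := by
  refine Submonoid.list_prod_mem _ ?_
  simp only [List.mem_map, forall_exists_index, and_imp]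
  rintro _ i - rfl
  exact rot_mem_unitary (hs i) (hb i) _

/-- At zero angles all factors are `1`, so the product rule merely adds up the axes. -/
theorem exists_hasStrictFDerivAt_rotProd [Fintype ι] (b : ι → A) (l : List ι) :
    rotProd b l 0 = 1 ∧ ∃ D : (ι → ℝ) →L[ℝ] A, HasStrictFDerivAt (rotProd b l) D 0 ∧
      ∀ v, D v = (l.map fun i => ((v i : ℂ) * Complex.I) • b i).sum := by
  induction l with
  | nil => exact ⟨rfl, 0, hasStrictFDerivAt_const _ _, fun v => by simp⟩
  | cons i l ih =>
    obtain ⟨h0, D, hD, hv⟩ := ih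
    have h1 : rotProd b (i :: l) = fun θ => rot (b i) (θ i) * rotProd b l θ := by
      ext θ; simp [rotProd]
    have h2 : HasStrictFDerivAt (fun θ : ι → ℝ => rot (b i) (θ i)) _ 0 :=
      HasStrictFDerivAt.comp (g := rot (b i)) (f := fun θ : ι → ℝ => θ i) (0 : ι → ℝ)
        (hasStrictDerivAt_rot (b i)).hasStrictFDerivAt
        (ContinuousLinearMap.proj (R := ℝ) (φ := fun _ : ι => ℝ) i).hasStrictFDerivAt
    have h3 : HasStrictFDerivAt (fun θ => rot (b i) (θ i) * rotProd b l θ) _ 0 := h2.mul' hD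
    refine ⟨by rw [h1]; simp [h0], _, h1.symm ▸ h3, fun v => ?_⟩
    simp [h0, hv, add_comm, mul_smul]

/-- If every selfadjoint element is a real combination of the involutions `b i`, then every unitary
near `1` is a product of rotations about the `b i`. -/
theorem exists_forall_unitary_eq_rotProd [Fintype ι] {b : ι → A} (hs : ∀ i, star (b i) = b i)
    (hb : ∀ i, b i * b i = 1)
    (hspan : ∀ K : A, star K = K → ∃ c : ι → ℝ, K = ∑ i, (c i : ℂ) • b i) :
    ∃ η > 0, ∀ U ∈ unitary A, ‖U - 1‖ < η → ∃ θ, U = rotProd b Finset.univ.toList θ := by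
  obtain ⟨h0, D, hD, hv⟩ := exists_hasStrictFDerivAt_rotProd b Finset.univ.toList
  -- The rotations reach only the skew-adjoint directions. The extra factor `1 + T B`, with `T B`
  -- selfadjoint, supplies the others and makes `Φ` a submersion at the origin; it is shown to be
  -- trivial when the value is unitary.
  let T : A →L[ℝ] A := ContinuousLinearMap.id ℝ A + (starL' ℝ : A ≃L[ℝ] A).toContinuousLinearMap
  have hT : ∀ B, T B = B + star B := fun B => rfl
  let Φ : (ι → ℝ) × A → A := fun x => rotProd b Finset.univ.toList x.1 * (1 + T x.2)
  have hΦ0 : Φ 0 = 1 := by simp [Φ, h0]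
  have h1 : HasStrictFDerivAt (fun x : (ι → ℝ) × A => rotProd b Finset.univ.toList x.1)
      (D.comp (ContinuousLinearMap.fst ℝ _ _)) 0 :=
    HasStrictFDerivAt.comp (f := Prod.fst) (0 : (ι → ℝ) × A) hD hasStrictFDerivAt_fst
  have h2 : HasStrictFDerivAt (fun x : (ι → ℝ) × A => 1 + T x.2)
      (T.comp (ContinuousLinearMap.snd ℝ _ _)) 0 :=
    (T.comp (ContinuousLinearMap.snd ℝ (ι → ℝ) A)).hasStrictFDerivAt.const_add 1
  have hΦ := h1.mul' h2
  have hmap := HasStrictFDerivAt.map_nhds_eq_of_surj (f := Φ) hΦ (by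
    rw [LinearMap.range_eq_top]
    intro M
    -- `M` is split into its skew part `(M - star M) / 2`, which is `i` times this selfadjoint
    -- element, and its selfadjoint part, which is `T` of `(M + star M) / 4`.
    obtain ⟨c, hc⟩ := hspan (-((1 / 2 : ℂ) * Complex.I) • (M - star M)) (by
      simp [star_smul, star_sub]
      module)
    refine ⟨(c, (1 / 4 : ℂ) • (M + star M)), ?_⟩
    have hsum : D c = Complex.I • (-((1 / 2 : ℂ) * Complex.I) • (M - star M)) := by
      rw [hv, hc, Finset.sum_map_toList, Finset.smul_sum]
      exact Finset.sum_congr rfl fun i _ => by rw [smul_smul, mul_comm]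
    have hI : Complex.I * (-((1 / 2 : ℂ) * Complex.I)) = 1 / 2 := by
      linear_combination (-(1 / 2 : ℂ)) * Complex.I_mul_I
    rw [smul_smul, hI] at hsum
    simp [h0, hT, hsum, star_smul]
    module)
  have hnear : ∀ᶠ x : (ι → ℝ) × A in 𝓝 0, ‖T x.2‖ < 1 := by
    have : Continuous fun x : (ι → ℝ) × A => ‖T x.2‖ := by fun_prop
    exact this.continuousAt.eventually (gt_mem_nhds (by simp))
  have himg : Φ '' {x | ‖T x.2‖ < 1} ∈ 𝓝 (1 : A) := by
    rw [← hΦ0, ← hmap]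
    exact Filter.image_mem_map hnear
  obtain ⟨η, hη, hball⟩ := Metric.mem_nhds_iff.1 himg
  refine ⟨η, hη, fun U hU hUη => ?_⟩
  obtain ⟨⟨θ, B⟩, hB, hUB⟩ := hball (by rwa [Metric.mem_ball, dist_eq_norm] : U ∈ _)
  refine ⟨θ, ?_⟩
  have hV := rotProd_mem_unitary hs hb Finset.univ.toList θ
  set V := rotProd b Finset.univ.toList θ
  set K := T B with hK
  have hKs : star K = K := by rw [hK, hT, star_add, star_star, add_comm]
  have hK1 : ‖K‖ < 1 := hB
  have hUV : U = V * (1 + K) := hUB.symm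
  -- `1 + K` is unitary and selfadjoint, so `(1 + K) ^ 2 = 1` and `2 K = -K ^ 2`; with `‖K‖ < 1`
  -- this forces `K = 0`.
  have hW : 1 + K = star V * U := by
    rw [hUV, ← mul_assoc, (Unitary.mem_iff.1 hV).1, one_mul]
  have hWu : 1 + K ∈ unitary A := hW ▸ mul_mem (Unitary.star_mem hV) hU
  have hsq := (Unitary.mem_iff.1 hWu).1
  rw [star_add, star_one, hKs] at hsq
  have hK2 : (2 : ℂ) • K = -(K * K) := by
    rw [two_smul, eq_neg_iff_add_eq_zero]
    have : (1 + K) * (1 + K) = 1 + (K + K + K * K) := by noncomm_ring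
    rw [this] at hsq
    simpa using hsq
  have hK3 : 2 * ‖K‖ ≤ ‖K‖ * ‖K‖ := by
    have h3 := congrArg norm hK2
    rw [norm_smul, norm_neg] at h3
    have h4 := norm_mul_le K K
    simp only [Complex.norm_ofNat] at h3
    linarith
  have hK0 : ‖K‖ = 0 := by nlinarith [norm_nonneg K]
  rw [hUV, norm_eq_zero.1 hK0, add_zero, mul_one]

end Rotations

/-! ### Pauli strings span the selfadjoint operators. -/

section PauliStrings

variable {m : ℕ}

/-- The tensor product of one-qubit operators. -/
def tensorOp (p : Fin m → Matrix (Fin 2) (Fin 2) ℂ) : QOp m := fun x y => ∏ i, p i (x i) (y i)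

theorem tensorOp_mul (p q : Fin m → Matrix (Fin 2) (Fin 2) ℂ) :
    tensorOp p * tensorOp q = tensorOp (p * q) := by
  ext x y
  simp only [Matrix.mul_apply, tensorOp, Pi.mul_apply, ← Finset.prod_mul_distrib]
  rw [Finset.prod_univ_sum, Fintype.piFinset_univ]

theorem tensorOp_one : tensorOp (1 : Fin m → Matrix (Fin 2) (Fin 2) ℂ) = 1 := by
  ext x y
  simp only [tensorOp, Pi.one_apply, Matrix.one_apply, Finset.prod_ite_zero, funext_iff]
  simp

theorem star_tensorOp (p : Fin m → Matrix (Fin 2) (Fin 2) ℂ) :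
    star (tensorOp p) = tensorOp (star p) := by
  ext x y
  simp [tensorOp, Matrix.star_apply, Pi.star_apply]

theorem tensorOp_update_smul (p : Fin m → Matrix (Fin 2) (Fin 2) ℂ) (b : Fin m) (c : ℂ)
    (s : Matrix (Fin 2) (Fin 2) ℂ) :
    tensorOp (Function.update p b (c • s)) = c • tensorOp (Function.update p b s) := by
  ext x y
  simp only [tensorOp, Matrix.smul_apply, smul_eq_mul]
  rw [← Finset.mul_prod_erase _ _ (Finset.mem_univ b),
    ← Finset.mul_prod_erase _ _ (Finset.mem_univ b), Function.update_self, Function.update_self,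
    Matrix.smul_apply, smul_eq_mul, mul_assoc]
  congr 2
  refine Finset.prod_congr rfl fun i hi => ?_
  rw [Function.update_of_ne (Finset.ne_of_mem_erase hi),
    Function.update_of_ne (Finset.ne_of_mem_erase hi)]

theorem tensorOp_actsOnlyOn {p : Fin m → Matrix (Fin 2) (Fin 2) ℂ} {T : Finset (Fin m)}
    (h : ∀ i, i ∉ T → p i = 1) : ActsOnlyOn (tensorOp p) T := by
  rw [actsOnlyOn_iff]
  constructor
  · intro x y hxy
    push Not at hxy
    obtain ⟨i, hi, hne⟩ := hxy
    refine Finset.prod_eq_zero (Finset.mem_univ i) ?_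
    rw [h i hi, Matrix.one_apply_ne hne]
  · intro x y x' y' hxy hxy' hx hy
    refine Finset.prod_congr rfl fun i _ => ?_
    by_cases hi : i ∈ T
    · rw [hx i hi, hy i hi]
    · rw [h i hi, hxy i hi, hxy' i hi, Matrix.one_apply_eq, Matrix.one_apply_eq]

/-- The identity and the Pauli matrices. -/
def pauli : Fin 4 → Matrix (Fin 2) (Fin 2) ℂ :=
  ![1, !![0, 1; 1, 0], !![0, -Complex.I; Complex.I, 0], !![1, 0; 0, -1]]

theorem star_pauli (a : Fin 4) : star (pauli a) = pauli a := by
  fin_cases a <;> ext i j <;> fin_cases i <;> fin_cases j <;>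
    simp [pauli, Matrix.star_apply]

theorem pauli_mul_self (a : Fin 4) : pauli a * pauli a = 1 := by
  fin_cases a <;> ext i j <;> fin_cases i <;> fin_cases j <;>
    simp [pauli, Matrix.mul_apply, Matrix.one_apply, Fin.sum_univ_two]

/-- Every Pauli matrix is `i` times the product of two anticommuting ones. -/
theorem exists_pauli_mul_pauli {a : Fin 4} (ha : a ≠ 0) :
    ∃ q r, Complex.I • (pauli q * pauli r) = pauli a ∧
      pauli q * pauli r = (-1 : ℂ) • (pauli r * pauli q) := by
  have h : ∀ q r : Fin 4, ∀ c : Fin 4, Complex.I • (pauli q * pauli r) = pauli c →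
      pauli q * pauli r = (-1 : ℂ) • (pauli r * pauli q) → a = c →
      ∃ q r, Complex.I • (pauli q * pauli r) = pauli a ∧
      pauli q * pauli r = (-1 : ℂ) • (pauli r * pauli q) := fun q r c h1 h2 h3 =>
    ⟨q, r, h3 ▸ h1, h2⟩
  fin_cases a
  · exact absurd rfl ha
  · refine h 3 2 1 ?_ ?_ rfl <;> ext i j <;> fin_cases i <;> fin_cases j <;>
      simp [pauli, Matrix.mul_apply, Fin.sum_univ_two]
  · refine h 1 3 2 ?_ ?_ rfl <;> ext i j <;> fin_cases i <;> fin_cases j <;>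
      simp [pauli, Matrix.mul_apply, Fin.sum_univ_two]
  · refine h 2 1 3 ?_ ?_ rfl <;> ext i j <;> fin_cases i <;> fin_cases j <;>
      simp [pauli, Matrix.mul_apply, Fin.sum_univ_two]

theorem exists_eq_sum_pauli (E : Matrix (Fin 2) (Fin 2) ℂ) :
    ∃ c : Fin 4 → ℂ, E = ∑ a, c a • pauli a := by
  refine ⟨![(E 0 0 + E 1 1) / 2, (E 0 1 + E 1 0) / 2, Complex.I * (E 0 1 - E 1 0) / 2,
    (E 0 0 - E 1 1) / 2], ?_⟩
  have hI := Complex.I_mul_I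
  ext i j
  fin_cases i <;> fin_cases j <;>
    simp [pauli, Fin.sum_univ_four, Matrix.add_apply]
  · ring
  · linear_combination (E 0 1 - E 1 0) / 2 * hI
  · linear_combination (E 1 0 - E 0 1) / 2 * hI
  · ring

theorem tensorOp_mem_span_pauli (p : Fin m → Matrix (Fin 2) (Fin 2) ℂ) :
    tensorOp p ∈ Submodule.span ℂ
      (Set.range fun f : Fin m → Fin 4 => tensorOp fun i => pauli (f i)) := by
  choose c hc using fun i => exists_eq_sum_pauli (p i)
  have h : tensorOp p = ∑ f : Fin m → Fin 4, (∏ i, c i (f i)) • tensorOp fun i => pauli (f i) := by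
    ext x y
    simp only [Matrix.sum_apply, Matrix.smul_apply, tensorOp, smul_eq_mul,
      ← Finset.prod_mul_distrib]
    have h2 : ∀ i, p i (x i) (y i) = ∑ a, c i a * pauli a (x i) (y i) := fun i => by
      conv_lhs => rw [hc i]
      simp [Matrix.sum_apply]
    simp only [h2]
    rw [Finset.prod_univ_sum, Fintype.piFinset_univ]
  rw [h]
  exact Submodule.sum_mem _ fun f _ => Submodule.smul_mem _ _ (Submodule.subset_span ⟨f, rfl⟩)

/-- A matrix unit is a tensor product of one-qubit matrix units, and each of these is a combination
of Pauli matrices. -/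
theorem exists_eq_sum_pauliString (M : QOp m) :
    ∃ c : (Fin m → Fin 4) → ℂ, M = ∑ f, c f • tensorOp fun i => pauli (f i) := by
  have hM : M ∈ Submodule.span ℂ
      (Set.range fun f : Fin m → Fin 4 => tensorOp fun i => pauli (f i)) := by
    rw [Matrix.matrix_eq_sum_single M]
    refine Submodule.sum_mem _ fun x _ => Submodule.sum_mem _ fun y _ => ?_
    have h : Matrix.single x y (M x y) =
        M x y • tensorOp fun i => Matrix.single (x i) (y i) (1 : ℂ) := by
      ext u v
      simp only [tensorOp, Matrix.smul_apply, Matrix.single_apply, smul_eq_mul,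
        Finset.prod_ite_zero, funext_iff, forall_and]
      simp
    rw [h]
    exact Submodule.smul_mem _ _ (tensorOp_mem_span_pauli _)
  obtain ⟨c, hc⟩ := (Submodule.mem_span_range_iff_exists_fun ℂ).1 hM
  exact ⟨c, hc.symm⟩

theorem star_pauliString (f : Fin m → Fin 4) :
    star (tensorOp fun i => pauli (f i)) = tensorOp fun i => pauli (f i) := by
  rw [star_tensorOp]
  congr 1
  ext1 i
  exact star_pauli (f i)

theorem pauliString_mul_self (f : Fin m → Fin 4) :
    (tensorOp fun i => pauli (f i)) * (tensorOp fun i => pauli (f i)) = 1 := by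
  rw [tensorOp_mul, ← tensorOp_one]
  congr 1
  ext1 i
  exact pauli_mul_self (f i)

/-- Every selfadjoint operator is a real combination of Pauli strings. -/
theorem exists_eq_real_sum_pauliString {K : QOp m} (hK : star K = K) :
    ∃ c : (Fin m → Fin 4) → ℝ, K = ∑ f, (c f : ℂ) • tensorOp fun i => pauli (f i) := by
  obtain ⟨c, hc⟩ := exists_eq_sum_pauliString K
  refine ⟨fun f => (c f).re, ?_⟩
  have h1 : K = (1 / 2 : ℂ) • (K + star K) := by rw [hK]; module
  rw [h1]
  conv_lhs => rw [hc]
  simp only [star_sum, star_smul, star_pauliString, ← Finset.sum_add_distrib, ← add_smul,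
    Finset.smul_sum, smul_smul]
  refine Finset.sum_congr rfl fun f _ => ?_
  congr 1
  rw [Complex.star_def, Complex.add_conj]
  push_cast
  ring

end PauliStrings

/-! ### Exact universality of two-qubit gates. -/

section Circuits

variable {n : ℕ}

/-- `U` is implemented exactly by a circuit of at most `N` elementary gates. -/
def HasCircuit (U : QOp n) (N : ℕ) : Prop := ∃ c : QCircuit n, c.toOp = U ∧ c.length ≤ N

theorem HasCircuit.mono {U : QOp n} {N N' : ℕ} (h : HasCircuit U N) (hN : N ≤ N') :
    HasCircuit U N' := by
  obtain ⟨c, hc, hl⟩ := h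
  exact ⟨c, hc, hl.trans hN⟩

theorem hasCircuit_one : HasCircuit (1 : QOp n) 0 := ⟨[], rfl, le_rfl⟩

theorem HasCircuit.mul {U V : QOp n} {N N' : ℕ} (hU : HasCircuit U N) (hV : HasCircuit V N') :
    HasCircuit (U * V) (N + N') := by
  obtain ⟨c, rfl, hc⟩ := hU
  obtain ⟨c', rfl, hc'⟩ := hV
  refine ⟨c' ++ c, by simp [QCircuit.toOp], ?_⟩
  rw [List.length_append]
  omega

theorem HasCircuit.list_prod {l : List (QOp n)} {N : ℕ} (h : ∀ U ∈ l, HasCircuit U N) :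
    HasCircuit l.prod (l.length * N) := by
  induction l with
  | nil => exact hasCircuit_one.mono (Nat.zero_le _)
  | cons U l ih =>
    rw [List.prod_cons]
    refine ((h U (by simp)).mul (ih fun V hV => h V (by simp [hV]))).mono (le_of_eq ?_)
    rw [List.length_cons]
    ring

theorem HasCircuit.pow {U : QOp n} {N : ℕ} (h : HasCircuit U N) (r : ℕ) :
    HasCircuit (U ^ r) (r * N) := by
  have := HasCircuit.list_prod (l := List.replicate r U) fun V hV => by
    rwa [List.eq_of_mem_replicate hV]
  simpa using this

theorem hasCircuit_of_actsOnlyOn {U : QOp n} (hU : U ∈ unitary (QOp n)) {S : Finset (Fin n)}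
    (hS : S.card ≤ 2) (h : ActsOnlyOn U S) : HasCircuit U 1 :=
  ⟨[⟨U, hU, S, hS, h⟩], by simp [QCircuit.toOp], le_rfl⟩

/-- Rotations about a Pauli string have circuits whose length does not depend on the angle. -/
theorem exists_hasCircuit_rot_pauliString (T : Finset (Fin n)) (f : Fin n → Fin 4)
    (hf : ∀ i, f i ≠ 0 ↔ i ∈ T) :
    ∃ N, ∀ θ, HasCircuit (rot (tensorOp fun i => pauli (f i)) θ) N := by
  have hp0 : pauli 0 = 1 := rfl
  have hgate : ∀ (T : Finset (Fin n)) (f : Fin n → Fin 4), (∀ i, i ∉ T → f i = 0) → T.card ≤ 2 →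
      ∀ θ, HasCircuit (rot (tensorOp fun i => pauli (f i)) θ) 1 := by
    intro T f hf hT θ
    refine hasCircuit_of_actsOnlyOn (rot_mem_unitary (star_pauliString f) (pauliString_mul_self f) θ)
      hT (((actsOnlyOn_one T).smul _).add (ActsOnlyOn.smul _ (tensorOp_actsOnlyOn ?_)))
    intro i hi
    rw [hf i hi, hp0]
  induction T using Finset.strongInduction generalizing f with
  | H T ih =>
    rcases le_or_gt T.card 2 with hT | hT
    · exact ⟨1, hgate T f (fun i hi => by by_contra h; exact hi ((hf i).1 h)) hT⟩
    -- With `pauli (f b) = i q r`, the string `f` equals `i g h`, where `g` drops qubit `a` and has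
    -- `q` at `b`, and `h` is `f a` at `a` and `r` at `b`. These anticommute, so the rotation about
    -- `f` is the two-qubit rotation about `h` conjugated by a rotation about the shorter string `g`
    -- through a fixed angle.
    obtain ⟨a, ha, b, hb, hab⟩ := Finset.one_lt_card.1 (by omega : 1 < T.card)
    obtain ⟨q, r, hqr, hanti⟩ := exists_pauli_mul_pauli ((hf b).2 hb)
    -- The identity anticommutes with no Pauli matrix; hence the support of `g` is exactly `T.erase
    -- a`.
    have hne : ∀ {q r : Fin 4}, pauli q * pauli r = (-1 : ℂ) • (pauli r * pauli q) → q ≠ 0 := by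
      rintro q r h rfl
      rw [hp0, one_mul, mul_one] at h
      have h2 : (2 : ℂ) • pauli r = 0 := by
        rw [two_smul]; nth_rewrite 1 [h]; simp
      have h3 := (smul_eq_zero.1 h2).resolve_left two_ne_zero
      have h4 := pauli_mul_self r
      rw [h3, mul_zero] at h4
      exact zero_ne_one h4
    set g : Fin n → Fin 4 := Function.update (Function.update f a 0) b q with hg
    set h : Fin n → Fin 4 := Function.update (Function.update 0 a (f a)) b r with hh
    obtain ⟨N, hN⟩ := ih (T.erase a) (Finset.erase_ssubset ha) g (by
      intro i
      rw [hg, Finset.mem_erase]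
      by_cases hib : i = b
      · subst hib
        simp [hne hanti, hb, hab.symm]
      · rw [Function.update_of_ne hib]
        by_cases hia : i = a
        · simp [hia]
        · rw [Function.update_of_ne hia, hf]; simp [hia])
    have hB := hgate {a, b} h (by
      intro i hi
      simp only [Finset.mem_insert, Finset.mem_singleton, not_or] at hi
      rw [hh, Function.update_of_ne hi.2, Function.update_of_ne hi.1]
      rfl) (Finset.card_le_two)
    have hgp : (fun i => pauli (g i)) =
        Function.update (Function.update (fun i => pauli (f i)) a 1) b (pauli q) := by
      ext1 i
      simp only [hg, Function.update_apply]
      split_ifs <;> simp [hp0]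
    have hhp : (fun i => pauli (h i)) =
        Function.update (Function.update (1 : Fin n → Matrix (Fin 2) (Fin 2) ℂ) a (pauli (f a))) b
          (pauli r) := by
      ext1 i
      simp only [hh, Function.update_apply]
      split_ifs <;> simp [hp0]
    have hfp : ∀ s, Function.update (Function.update (fun i => pauli (f i)) a 1 *
        Function.update (1 : Fin n → Matrix (Fin 2) (Fin 2) ℂ) a (pauli (f a))) b s = Function.update (fun i => pauli (f i)) b s := by
      intro s
      rw [← Function.update_mul]
      simp
    have hfp' : ∀ s, Function.update
        (Function.update (1 : Fin n → Matrix (Fin 2) (Fin 2) ℂ) a (pauli (f a)) *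
        Function.update (fun i => pauli (f i)) a 1) b s =
          Function.update (fun i => pauli (f i)) b s := by
      intro s
      rw [← Function.update_mul]
      simp
    have hgh : (tensorOp fun i => pauli (g i)) * (tensorOp fun i => pauli (h i)) =
        tensorOp (Function.update (fun i => pauli (f i)) b (pauli q * pauli r)) := by
      rw [tensorOp_mul, hgp, hhp, ← Function.update_mul, hfp]
    have hhg : (tensorOp fun i => pauli (h i)) * (tensorOp fun i => pauli (g i)) =
        tensorOp (Function.update (fun i => pauli (f i)) b (pauli r * pauli q)) := by
      rw [tensorOp_mul, hgp, hhp, ← Function.update_mul, hfp']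
    have hconj := rot_mul_mul_rot_neg (pauliString_mul_self g) (b := tensorOp fun i => pauli (h i))
      (by rw [hgh, hhg, hanti, tensorOp_update_smul, neg_one_smul])
    rw [hgh, ← tensorOp_update_smul, hqr, Function.update_eq_self b fun i => pauli (f i)] at hconj
    refine ⟨N + 1 + N, fun θ => ?_⟩
    rw [← hconj, rot_conj (rot_mul_rot_neg (pauliString_mul_self g) _)]
    exact ((hN _).mul (hB θ)).mul (hN _)

theorem exists_hasCircuit_near_one (n : ℕ) :
    ∃ η > 0, ∃ N, ∀ U ∈ unitary (QOp n), ‖U - 1‖ < η → HasCircuit U N := by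
  obtain ⟨η, hη, h⟩ := exists_forall_unitary_eq_rotProd
    (b := fun f : Fin n → Fin 4 => tensorOp fun i => pauli (f i)) star_pauliString
    pauliString_mul_self fun K hK => exists_eq_real_sum_pauliString hK
  choose N hN using fun f : Fin n → Fin 4 =>
    exists_hasCircuit_rot_pauliString (Finset.univ.filter fun i => f i ≠ 0) f (by simp)
  refine ⟨η, hη, (Finset.univ : Finset (Fin n → Fin 4)).toList.length * ∑ f, N f, fun U hU hUη => ?_⟩
  obtain ⟨θ, rfl⟩ := h U hU hUη
  have := HasCircuit.list_prod (l := (Finset.univ.toList : List (Fin n → Fin 4)).map fun f =>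
    rot (tensorOp fun i => pauli (f i)) (θ f)) (N := ∑ f, N f) (by
      simp only [List.mem_map, forall_exists_index, and_imp]
      rintro _ f - rfl
      exact (hN f _).mono (Finset.single_le_sum (fun _ _ => Nat.zero_le _) (Finset.mem_univ f)))
  rwa [List.length_map] at this

/-- The exponential of a skew-adjoint matrix is a power of a unitary matrix near `1`. -/
theorem exists_unitary_pow_eq_exp {d : Type*} [Fintype d] [DecidableEq d] {B : Matrix d d ℂ}
    (hB : B ∈ skewAdjoint (Matrix d d ℂ)) {N : ℕ} (hN : 0 < N) :
    ∃ W ∈ unitary (Matrix d d ℂ), ‖W - 1‖ ≤ Real.pi / N ∧ W ^ N = NormedSpace.exp B := by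
  have hK : (Complex.I • B).IsHermitian := by
    have : star B = -B := skewAdjoint.mem_iff.1 hB
    change star (Complex.I • B) = _
    rw [star_smul, this]
    simp
  set V := hK.eigenvectorUnitary with hV
  set D : (d → ℂ) → Matrix d d ℂ := fun v => (V : Matrix d d ℂ) * Matrix.diagonal v *
    star (V : Matrix d d ℂ) with hD
  have hVV : (V : Matrix d d ℂ) * star (V : Matrix d d ℂ) = 1 := (Unitary.mem_iff.1 V.2).2
  have hVV' : star (V : Matrix d d ℂ) * (V : Matrix d d ℂ) = 1 := (Unitary.mem_iff.1 V.2).1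
  have hmul : ∀ v w, D v * D w = D (v * w) := by
    intro v w
    simp only [hD]
    have : ∀ x y z w' u t : Matrix d d ℂ, x * y * z * (w' * u * t) = x * (y * (z * w') * u) * t :=
      fun _ _ _ _ _ _ => by noncomm_ring
    rw [this, hVV', mul_one, Matrix.diagonal_mul_diagonal]
    rfl
  have hone : D 1 = 1 := by
    simp only [hD]
    rw [Matrix.diagonal_one', mul_one, hVV]
  have hstar : ∀ v, star (D v) = D (star v) := by
    intro v
    simp only [hD, star_mul, star_star, mul_assoc]
    congr 2
    rw [Matrix.star_eq_conjTranspose, Matrix.diagonal_conjTranspose]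
  have hpow : ∀ v (r : ℕ), D v ^ r = D (v ^ r) := by
    intro v r
    induction r with
    | zero => rw [pow_zero, pow_zero, hone]
    | succ r ih => rw [pow_succ, pow_succ, ih, hmul]
  have hBD : B = D fun i => -(Complex.I * (hK.eigenvalues i : ℂ)) := by
    have h := hK.spectral_theorem
    rw [Unitary.conjStarAlgAut_apply] at h
    have h2 : B = (-Complex.I) • (Complex.I • B) := by simp [smul_smul]
    refine h2.trans ((congrArg ((-Complex.I) • ·) h).trans ?_)
    change (-Complex.I) • ((V : Matrix d d ℂ) * Matrix.diagonal _ * star (V : Matrix d d ℂ)) =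
      (V : Matrix d d ℂ) * Matrix.diagonal _ * star (V : Matrix d d ℂ)
    rw [← smul_mul_assoc, ← mul_smul_comm, ← Matrix.diagonal_smul]
    congr 3
    ext i
    simp
  have hexp : NormedSpace.exp B =
      D fun i => Complex.exp (-(Complex.I * (hK.eigenvalues i : ℂ))) := by
    have hinv : (V : Matrix d d ℂ)⁻¹ = star (V : Matrix d d ℂ) := Matrix.inv_eq_right_inv hVV
    have hu : IsUnit (V : Matrix d d ℂ) := IsUnit.of_mul_eq_one _ hVV
    conv_lhs => rw [hBD]
    simp only [hD, ← hinv]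
    rw [Matrix.exp_conj _ _ hu, Matrix.exp_diagonal]
    congr 3
    ext i
    rw [Pi.coe_exp, Complex.exp_eq_exp_ℂ]
  set z : d → ℂ := fun i => Complex.exp (-(Complex.I * (hK.eigenvalues i : ℂ))) with hz
  have hz1 : ∀ i, ‖z i‖ = 1 := by
    intro i
    rw [hz]
    simp [Complex.norm_exp]
  -- The root is taken of the eigenvalues of the exponential with arguments in `(-π, π]`, not by
  -- dividing `B` by `N`. This makes the distance `π / N` to the identity independent of `B`.
  set w : d → ℂ := fun i => Complex.exp (Complex.I * ((Complex.arg (z i) / N : ℝ) : ℂ)) with hw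
  have hN0 : (N : ℂ) ≠ 0 := by exact_mod_cast hN.ne'
  have hwN : w ^ N = z := by
    ext i
    rw [Pi.pow_apply, hw, ← Complex.exp_nat_mul]
    have := Complex.norm_mul_exp_arg_mul_I (z i)
    rw [hz1, Complex.ofReal_one, one_mul] at this
    conv_rhs => rw [← this]
    congr 1
    push_cast
    field_simp
  have hww : w * star w = 1 := by
    ext i
    rw [Pi.mul_apply, Pi.star_apply, Complex.star_def, Complex.mul_conj, Complex.normSq_eq_norm_sq,
      hw]
    dsimp only
    rw [mul_comm Complex.I, Complex.norm_exp_ofReal_mul_I]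
    simp
  refine ⟨D w, ?_, ?_, ?_⟩
  · rw [Unitary.mem_iff, hstar, hmul, hmul, mul_comm (star w), hww, hone]
    exact ⟨rfl, rfl⟩
  · have hsub : D w - 1 = (V : Matrix d d ℂ) * Matrix.diagonal (fun i => w i - 1) *
        star (V : Matrix d d ℂ) := by
      rw [← hone]
      simp only [hD]
      rw [← sub_mul, ← mul_sub, Matrix.diagonal_sub]
      rfl
    rw [hsub, CStarRing.norm_mul_mem_unitary _ (Unitary.star_mem V.2),
      CStarRing.norm_mem_unitary_mul _ V.2, Matrix.l2_opNorm_diagonal,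
      pi_norm_le_iff_of_nonneg (by positivity)]
    intro i
    refine (Real.norm_exp_I_mul_ofReal_sub_one_le).trans ?_
    rw [Real.norm_eq_abs, abs_div, Nat.abs_cast]
    gcongr
    exact Complex.abs_arg_le_pi _
  · rw [hpow, hwN, hexp]

/-- **Exact universality of two-qubit gates** for the exponentials on `m` qubits, with a uniform
bound on the number of gates. -/
theorem exists_hasCircuit_exp (m : ℕ) :
    ∃ N, ∀ B ∈ skewAdjoint (QOp m), HasCircuit (NormedSpace.exp B) N := by
  obtain ⟨η, hη, N, hN⟩ := exists_hasCircuit_near_one m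
  obtain ⟨M, hM⟩ := exists_nat_gt (Real.pi / η)
  have hM0 : 0 < M := by
    have : (0 : ℝ) < M := (div_pos Real.pi_pos hη).trans hM
    exact_mod_cast this
  refine ⟨M * N, fun B hB => ?_⟩
  obtain ⟨W, hW, hnear, hpow⟩ := exists_unitary_pow_eq_exp hB hM0
  rw [← hpow]
  refine (hN W hW (hnear.trans_lt ?_)).pow M
  rw [div_lt_iff₀ (by exact_mod_cast hM0)]
  rwa [div_lt_iff₀ hη, mul_comm] at hM

end Circuits

/-! ### Transfer of circuits from few qubits to `n` qubits. -/

section Embedding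

variable {n m : ℕ}

/-- The embedding of the operators on `m` qubits that are identified with the qubits in `S`. -/
def embedHom (S : Finset (Fin n)) (e : Fin m ≃ S) : QOp m →+* QOp n :=
  (localHom S).comp
    (Matrix.reindexAlgEquiv ℂ ℂ (Equiv.arrowCongr e (Equiv.refl (Fin 2)))).toAlgHom.toRingHom

theorem embedHom_apply (S : Finset (Fin n)) (e : Fin m ≃ S) (B : QOp m) (x y : Fin n → Fin 2) :
    embedHom S e B x y = B (fun a => x (e a)) (fun a => y (e a)) *
      if ∀ i, i ∉ S → x i = y i then 1 else 0 :=
  localHom_apply S _ x y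

theorem continuous_embedHom (S : Finset (Fin n)) (e : Fin m ≃ S) : Continuous (embedHom S e) := by
  refine continuous_pi fun x => continuous_pi fun y => ?_
  simp only [embedHom_apply]
  exact (continuous_id.matrix_elem _ _).mul continuous_const

theorem embedHom_star (S : Finset (Fin n)) (e : Fin m ≃ S) (B : QOp m) :
    embedHom S e (star B) = star (embedHom S e B) := by
  ext x y
  rw [Matrix.star_apply, embedHom_apply, embedHom_apply, Matrix.star_apply]
  simp only [eq_comm]
  split_ifs <;> simp

theorem embedHom_injective (S : Finset (Fin n)) (e : Fin m ≃ S) :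
    Function.Injective (embedHom S e) :=
  (localHom_injective S).comp (Matrix.reindexAlgEquiv ℂ ℂ _).injective

theorem exists_embedHom_eq {A : QOp n} {S : Finset (Fin n)} (hA : ActsOnlyOn A S)
    (e : Fin m ≃ S) : ∃ B, embedHom S e B = A := by
  obtain ⟨B, rfl⟩ := actsOnlyOn_iff_exists_localHom.1 hA
  obtain ⟨B', rfl⟩ :=
    (Matrix.reindexAlgEquiv ℂ ℂ (Equiv.arrowCongr e (Equiv.refl (Fin 2)))).surjective B
  exact ⟨B', rfl⟩

theorem embedHom_actsOnlyOn {S : Finset (Fin n)} (e : Fin m ≃ S) {B : QOp m} {T : Finset (Fin m)}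
    (hB : ActsOnlyOn B T) :
    ActsOnlyOn (embedHom S e B) (T.image fun a => (e a : Fin n)) := by
  rw [actsOnlyOn_iff] at hB ⊢
  have hsub : ∀ i, i ∉ S → i ∉ T.image fun a => (e a : Fin n) := by
    intro i hi hT
    obtain ⟨a, -, rfl⟩ := Finset.mem_image.1 hT
    exact hi (e a).2
  have hmem : ∀ a, a ∉ T → (e a : Fin n) ∉ T.image fun a => (e a : Fin n) := by
    intro a ha hT
    obtain ⟨a', ha', h⟩ := Finset.mem_image.1 hT
    exact ha (e.injective (Subtype.ext h) ▸ ha')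
  constructor
  · intro x y hxy
    rw [embedHom_apply]
    split_ifs with hS
    · rw [hB.1, zero_mul]
      intro hT
      refine hxy fun i hi => ?_
      by_cases hiS : i ∈ S
      · have := hT (e.symm ⟨i, hiS⟩) fun h => hi (Finset.mem_image.2 ⟨_, h, by simp⟩)
        simpa using this
      · exact hS i hiS
    · rw [mul_zero]
  · intro x y x' y' hxy hxy' hx hy
    rw [embedHom_apply, embedHom_apply, if_pos fun i hi => hxy i (hsub i hi),
      if_pos fun i hi => hxy' i (hsub i hi)]
    congr 1
    exact hB.2 _ _ _ _ (fun a ha => hxy _ (hmem a ha)) (fun a ha => hxy' _ (hmem a ha))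
      (fun a ha => hx _ (Finset.mem_image_of_mem _ ha))
      (fun a ha => hy _ (Finset.mem_image_of_mem _ ha))

theorem embedHom_mem_unitary (S : Finset (Fin n)) (e : Fin m ≃ S) {U : QOp m}
    (hU : U ∈ unitary (QOp m)) : embedHom S e U ∈ unitary (QOp n) := by
  rw [Unitary.mem_iff] at hU ⊢
  rw [← embedHom_star, ← map_mul, ← map_mul, hU.1, hU.2, map_one]
  exact ⟨rfl, rfl⟩

theorem HasCircuit.embedHom {S : Finset (Fin n)} (e : Fin m ≃ S) {U : QOp m} {N : ℕ}
    (h : HasCircuit U N) : HasCircuit (embedHom S e U) N := by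
  obtain ⟨c, rfl, hl⟩ := h
  let g : QGate m → QGate n := fun G =>
    { op := _root_.embedHom S e G.op
      unitary := embedHom_mem_unitary S e G.unitary
      local_two := by
        obtain ⟨T, hT, h⟩ := G.local_two
        exact ⟨_, Finset.card_image_le.trans hT, embedHom_actsOnlyOn e h⟩ }
  refine ⟨c.map g, ?_, by simpa using hl⟩
  rw [QCircuit.toOp, QCircuit.toOp, map_list_prod, List.map_reverse, List.map_map, List.map_map]
  rfl

/-- The exponential of a skew-adjoint operator on at most `k` qubits has a circuit whose length is
bounded in terms of `k`. -/
theorem exists_hasCircuit_exp_of_actsOnlyOn (k : ℕ) :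
    ∃ N, ∀ (n : ℕ) (A : QOp n) (S : Finset (Fin n)), A ∈ skewAdjoint (QOp n) → S.card ≤ k →
      ActsOnlyOn A S → HasCircuit (NormedSpace.exp A) N := by
  choose N hN using exists_hasCircuit_exp
  -- The sum dominates the bounds for all support sizes `m ≤ k` at once.
  refine ⟨∑ m ∈ Finset.range (k + 1), N m, fun n A S hA hS hAS => ?_⟩
  let e : Fin S.card ≃ S := S.equivFin.symm
  obtain ⟨B, rfl⟩ := exists_embedHom_eq hAS e
  have hB : B ∈ skewAdjoint (QOp S.card) := by
    rw [skewAdjoint.mem_iff] at hA ⊢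
    apply embedHom_injective S e
    rw [embedHom_star, hA, map_neg]
  let _ : NormedAlgebra ℚ (QOp S.card) := NormedAlgebra.restrictScalars ℚ ℂ (QOp S.card)
  rw [← NormedSpace.map_exp (_root_.embedHom S e) (continuous_embedHom S e)]
  exact ((hN _ B hB).embedHom e).mono
    (Finset.single_le_sum (f := N) (fun _ _ => Nat.zero_le _) (Finset.mem_range.2 (by omega)))

end Embedding

/-! ### Accumulation of errors over repeated steps. -/

section Telescoping

variable {A : Type*} [CStarAlgebra A]

theorem norm_pow_sub_pow_le_of_mem_unitary {U V : A} (hU : U ∈ unitary A) (hV : V ∈ unitary A)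
    (r : ℕ) : ‖U ^ r - V ^ r‖ ≤ r * ‖U - V‖ := by
  induction r with
  | zero => simp
  | succ r ih =>
    have h : U ^ (r + 1) - V ^ (r + 1) = U ^ r * (U - V) + (U ^ r - V ^ r) * V := by
      rw [pow_succ, pow_succ]; noncomm_ring
    rw [h]
    refine (norm_add_le _ _).trans ?_
    rw [CStarRing.norm_mem_unitary_mul _ (pow_mem hU r), CStarRing.norm_mul_mem_unitary _ hV]
    push_cast
    linarith

theorem flow_pow (B : A) (t : ℝ) (r : ℕ) : flow B t ^ r = flow B (r * t) := by
  induction r with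
  | zero => simp
  | succ r ih => rw [pow_succ, ih, ← flow_add]; push_cast; congr 1; ring

end Telescoping

/-! ### Trotter number and gate complexity. -/

namespace LocalHamiltonian

variable {n k : ℕ}

theorem evolution_pow (H : LocalHamiltonian n k) (t : ℝ) {r : ℕ} (hr : 0 < r) :
    H.evolution (t / r) ^ r = H.evolution t := by
  have : (r : ℝ) ≠ 0 := by exact_mod_cast hr.ne'
  rw [evolution_eq_flow, evolution_eq_flow, flow_pow, mul_div_cancel₀ _ this]

theorem evolution_mem_unitary (H : LocalHamiltonian n k) (t : ℝ) :
    H.evolution t ∈ unitary (QOp n) := by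
  rw [evolution_eq_flow]
  exact flow_mem_unitary H.sum_generator_mem_skewAdjoint t

theorem exists_trotter_error_bound (k p Υ : ℕ) (hp : 1 ≤ p) :
    ∃ C : ℝ, 1 ≤ C ∧ ∀ (n : ℕ) (H : LocalHamiltonian n k) (F : ProductFormula Υ (n ^ k)),
      F.IsOrder p H.generator → ∀ t : ℝ, 0 ≤ t →
        ‖H.trotterStep F t - H.evolution t‖ ≤
          C * (H.inducedOneNorm ^ p * H.oneNorm * t ^ (p + 1)) := by
  have hc := commConst_nonneg k p
  -- The added `1` ensures `C ≥ 1`, hence `C ≤ C ^ p`, so that the same constant serves for the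
  -- Trotter number without a `p`-th root.
  refine ⟨(Υ : ℝ) ^ (p + 1) * commConst k p + 1, le_add_of_nonneg_left (by positivity), ?_⟩
  intro n H F hF t ht
  have hI := H.inducedOneNorm_nonneg
  have hO := H.oneNorm_nonneg
  calc _ ≤ (Υ : ℝ) ^ (p + 1) * H.alphaComm p * t ^ (p + 1) :=
        H.norm_trotterStep_sub_evolution_le hp F hF ht
    _ ≤ (Υ : ℝ) ^ (p + 1) * (commConst k p * (H.inducedOneNorm ^ p * H.oneNorm)) * t ^ (p + 1) := by
        gcongr
        exact H.alphaComm_le p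
    _ = (Υ : ℝ) ^ (p + 1) * commConst k p * (H.inducedOneNorm ^ p * H.oneNorm * t ^ (p + 1)) := by
        ring
    _ ≤ _ := by gcongr; exact le_add_of_nonneg_right zero_le_one

theorem norm_trotterStep_pow_sub_evolution_le {Υ p : ℕ} (hp : 1 ≤ p) {C : ℝ} (hC : 1 ≤ C)
    (H : LocalHamiltonian n k) (F : ProductFormula Υ (n ^ k))
    (herr : ∀ t : ℝ, 0 ≤ t → ‖H.trotterStep F t - H.evolution t‖ ≤
          C * (H.inducedOneNorm ^ p * H.oneNorm * t ^ (p + 1)))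
    {t ε : ℝ} {r : ℕ} (ht : 0 ≤ t) (hε : 0 < ε) (hr : 0 < r)
    (hrC : C * (H.inducedOneNorm * H.oneNorm ^ (1 / (p : ℝ)) * t ^ (1 + 1 / (p : ℝ)) /
            ε ^ (1 / (p : ℝ))) ≤ (r : ℝ)) :
    ‖H.trotterStep F (t / r) ^ r - H.evolution t‖ ≤ ε := by
  have hI := H.inducedOneNorm_nonneg
  have hO := H.oneNorm_nonneg
  have hr' : (0 : ℝ) < r := by exact_mod_cast hr
  have hp' : (p : ℝ) ≠ 0 := by exact_mod_cast (by omega : p ≠ 0)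
  have hroot : ∀ a : ℝ, 0 ≤ a → (a ^ (1 / (p : ℝ))) ^ p = a := by
    intro a ha
    rw [one_div]
    exact Real.rpow_inv_natCast_pow ha (by omega)
  have htp : (t ^ (1 + 1 / (p : ℝ))) ^ p = t ^ (p + 1) := by
    rw [← Real.rpow_natCast, ← Real.rpow_mul ht, ← Real.rpow_natCast]
    congr 1
    push_cast
    field_simp
  have hkey : C * (H.inducedOneNorm ^ p * H.oneNorm * t ^ (p + 1)) ≤ ε * (r : ℝ) ^ p := by
    have h1 := pow_le_pow_left₀ (by positivity) hrC p
    rw [mul_pow, div_pow, mul_pow, mul_pow, hroot _ hO, htp, hroot _ hε.le] at h1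
    have h2 : C ≤ C ^ p := le_self_pow₀ hC (by omega)
    have h3 : C * (H.inducedOneNorm ^ p * H.oneNorm * t ^ (p + 1) / ε) ≤ (r : ℝ) ^ p :=
      (mul_le_mul_of_nonneg_right h2 (by positivity)).trans h1
    rw [← mul_div_assoc, div_le_iff₀ hε] at h3
    linarith
  rw [← H.evolution_pow t hr]
  refine (norm_pow_sub_pow_le_of_mem_unitary (H.trotterStep_mem_unitary F _)
    (H.evolution_mem_unitary _) r).trans ?_
  calc (r : ℝ) * ‖H.trotterStep F (t / r) - H.evolution (t / r)‖
      ≤ r * (C * (H.inducedOneNorm ^ p * H.oneNorm * (t / r) ^ (p + 1))) := by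
        gcongr
        exact herr _ (by positivity)
    _ = C * (H.inducedOneNorm ^ p * H.oneNorm * t ^ (p + 1)) / (r : ℝ) ^ p := by
        rw [div_pow, pow_succ (r : ℝ)]
        field_simp
    _ ≤ ε := by
        rw [div_le_iff₀ (by positivity)]
        exact hkey

theorem generator_actsOnlyOn (H : LocalHamiltonian n k) (γ : Fin (n ^ k)) :
    ∃ S : Finset (Fin n), S.card ≤ k ∧ ActsOnlyOn (H.generator γ) S :=
  ⟨_, Finset.card_image_le.trans (by simp), (H.support _).smul _⟩

theorem exists_hasCircuit_trotterStep (k Υ : ℕ) :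
    ∃ N : ℕ, 0 < N ∧ ∀ (n : ℕ) (H : LocalHamiltonian n k) (F : ProductFormula Υ (n ^ k)) (s : ℝ),
      HasCircuit (H.trotterStep F s) (N * n ^ k) := by
  obtain ⟨N, hN⟩ := exists_hasCircuit_exp_of_actsOnlyOn k
  -- The `+ 1` keeps the constant positive when `Υ * N = 0`.
  refine ⟨Υ * N + 1, Nat.succ_pos _, fun n H F s => ?_⟩
  have hstage : ∀ υ : Fin Υ, HasCircuit (List.ofFn fun γ : Fin (n ^ k) =>
      NormedSpace.exp (((s * F.coeff υ γ : ℝ) : ℂ) • H.generator (F.perm υ γ))).reverse.prod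
      (n ^ k * N) := by
    intro υ
    have := HasCircuit.list_prod (N := N) (l := (List.ofFn fun γ : Fin (n ^ k) =>
      NormedSpace.exp (((s * F.coeff υ γ : ℝ) : ℂ) • H.generator (F.perm υ γ))).reverse) (by
        intro U hU
        simp only [List.mem_reverse, List.mem_ofFn] at hU
        obtain ⟨γ, rfl⟩ := hU
        obtain ⟨S, hS, hact⟩ := H.generator_actsOnlyOn (F.perm υ γ)
        refine hN n _ S ?_ hS (hact.smul _)
        have := H.generator_mem_skewAdjoint (F.perm υ γ)
        rw [skewAdjoint.mem_iff] at this ⊢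
        rw [star_smul, this]
        simp [-Complex.ofReal_mul])
    simpa using this
  have := HasCircuit.list_prod (N := n ^ k * N) (l := (List.ofFn fun υ : Fin Υ =>
    (List.ofFn fun γ : Fin (n ^ k) => NormedSpace.exp (((s * F.coeff υ γ : ℝ) : ℂ) •
      H.generator (F.perm υ γ))).reverse.prod).reverse) (by
        intro U hU
        simp only [List.mem_reverse, List.mem_ofFn] at hU
        obtain ⟨υ, rfl⟩ := hU
        exact hstage υ)
  refine this.mono ?_
  simp only [List.length_reverse, List.length_ofFn]
  nlinarith [Nat.zero_le (n ^ k)]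

/-- The number of Trotter steps is at most of the order `|||H||| ‖H‖₁ ^ δ t ^ (1 + δ)`. -/
theorem trotterNumber_le (H : LocalHamiltonian n k) {p : ℕ} (hp : 1 ≤ p) {δ t : ℝ}
    (hδ : 1 / (p : ℝ) ≤ δ) (ht : 0 ≤ t) :
    H.inducedOneNorm * H.oneNorm ^ (1 / (p : ℝ)) * t ^ (1 + 1 / (p : ℝ)) ≤
      max 1 (H.inducedOneNorm * H.oneNorm ^ δ * t ^ (1 + δ)) := by
  have hI := H.inducedOneNorm_nonneg
  have hO := H.oneNorm_nonneg
  have hp' : (0 : ℝ) < 1 / p := by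
    have : (0 : ℝ) < p := by exact_mod_cast hp
    positivity
  -- In the form `(|||H|||₁ t) (‖H‖₁ t) ^ s` the quantity increases with `s` if `‖H‖₁ t ≥ 1`.
  -- Otherwise both factors are at most `1`, because `|||H|||₁ ≤ ‖H‖₁`.
  have hsplit : ∀ s : ℝ, 0 < s → H.inducedOneNorm * H.oneNorm ^ s * t ^ (1 + s) =
      H.inducedOneNorm * t * (H.oneNorm * t) ^ s := by
    intro s hs
    rw [Real.rpow_add' ht (by positivity), Real.rpow_one, Real.mul_rpow hO ht]
    ring
  rw [hsplit _ hp', hsplit _ (hp'.trans_le hδ)]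
  have hx : 0 ≤ H.oneNorm * t := mul_nonneg hO ht
  rcases le_or_gt 1 (H.oneNorm * t) with h | h
  · refine le_max_of_le_right ?_
    exact mul_le_mul_of_nonneg_left (Real.rpow_le_rpow_of_exponent_le h hδ) (by positivity)
  · refine le_max_of_le_left ?_
    have h1 : H.inducedOneNorm * t ≤ 1 :=
      (mul_le_mul_of_nonneg_right H.inducedOneNorm_le_oneNorm ht).trans h.le
    exact mul_le_one₀ h1 (Real.rpow_nonneg hx _) (Real.rpow_le_one hx h.le hp'.le)

theorem exists_simulatedWithGates (k p Υ : ℕ) (hp : 1 ≤ p) {δ ε : ℝ} (hδ : 1 / (p : ℝ) ≤ δ)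
    (hε : 0 < ε) : ∃ C : ℝ, 0 < C ∧
      ∀ (n : ℕ) (H : LocalHamiltonian n k) (F : ProductFormula Υ (n ^ k)),
        F.IsOrder p H.generator → ∀ t : ℝ, 0 ≤ t →
          H.SimulatedWithGates F t ε
            (C * ((n : ℝ) ^ k * max 1 (H.inducedOneNorm * H.oneNorm ^ δ * t ^ (1 + δ)))) := by
  obtain ⟨C, hC, herr⟩ := exists_trotter_error_bound k p Υ hp
  obtain ⟨N, hN, hcirc⟩ := exists_hasCircuit_trotterStep k Υ
  have hN' : (0 : ℝ) < N := by exact_mod_cast hN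
  have hε' : 0 < ε ^ (1 / (p : ℝ)) := Real.rpow_pos_of_pos hε _
  have hC0 : 0 < C := one_pos.trans_le hC
  refine ⟨(C / ε ^ (1 / (p : ℝ)) + 2) * N, by positivity, fun n H F hF t ht => ?_⟩
  set x := H.inducedOneNorm * H.oneNorm ^ (1 / (p : ℝ)) * t ^ (1 + 1 / (p : ℝ)) with hx
  set M := max 1 (H.inducedOneNorm * H.oneNorm ^ δ * t ^ (1 + δ)) with hM
  have hxM : x ≤ M := H.trotterNumber_le hp hδ ht
  have hx0 : 0 ≤ x := by
    have hI := H.inducedOneNorm_nonneg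
    have hO := H.oneNorm_nonneg
    positivity
  have hM1 : 1 ≤ M := le_max_left _ _
  -- The `+ 1` makes `r` positive even if `x = 0`. It and the rounding are absorbed by the summand
  -- `2` in the constant, since `M ≥ 1`.
  set r := ⌈C * (x / ε ^ (1 / (p : ℝ)))⌉₊ + 1 with hr
  obtain ⟨c, hc, hlen⟩ := (hcirc n H F (t / r)).pow r
  refine ⟨r, Nat.succ_pos _, c, hc, ?_, ?_⟩
  · refine norm_trotterStep_pow_sub_evolution_le hp hC H F (herr n H F hF) ht hε
      (Nat.succ_pos _) ?_
    refine (Nat.le_ceil _).trans ?_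
    rw [hr]
    push_cast
    linarith
  · have hceil : (r : ℝ) ≤ (C / ε ^ (1 / (p : ℝ)) + 2) * M := by
      have h1 := Nat.ceil_lt_add_one (a := C * (x / ε ^ (1 / (p : ℝ)))) (by positivity)
      have h2 : C * (x / ε ^ (1 / (p : ℝ))) ≤ C / ε ^ (1 / (p : ℝ)) * M := by
        rw [mul_div_assoc', mul_div_right_comm]
        gcongr
      rw [hr]
      push_cast
      linarith
    calc (c.length : ℝ) ≤ ((r * (N * n ^ k) : ℕ) : ℝ) := by exact_mod_cast hlen
      _ = r * (N * (n : ℝ) ^ k) := by push_cast; ring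
      _ ≤ (C / ε ^ (1 / (p : ℝ)) + 2) * M * (N * (n : ℝ) ^ k) := by gcongr
      _ = _ := by ring

end LocalHamiltonian

end

/-! ### Assembly of the theorem. -/

theorem theoremE1 (k : ℕ) (hk : 1 ≤ k) :
    -- commutator scaling
    (∀ p : ℕ, 1 ≤ p → ∃ C : ℝ, 0 < C ∧ ∀ (n : ℕ) (H : LocalHamiltonian n k),
      H.alphaComm p ≤ C * (H.inducedOneNorm ^ p * H.oneNorm)) ∧
    -- Trotter error and Trotter number
    (∀ p Υ : ℕ, 1 ≤ p → ∃ C : ℝ, 0 < C ∧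
      ∀ (n : ℕ) (H : LocalHamiltonian n k) (F : ProductFormula Υ (n ^ k)),
        F.IsOrder p H.generator →
        (∀ t : ℝ, 0 ≤ t →
          ‖H.trotterStep F t - H.evolution t‖ ≤
            C * (H.inducedOneNorm ^ p * H.oneNorm * t ^ (p + 1))) ∧
        (∀ (t ε : ℝ) (r : ℕ), 0 ≤ t → 0 < ε → 0 < r →
          C * (H.inducedOneNorm * H.oneNorm ^ (1 / (p : ℝ)) * t ^ (1 + 1 / (p : ℝ)) /
            ε ^ (1 / (p : ℝ))) ≤ (r : ℝ) →
          ‖H.trotterStep F (t / r) ^ r - H.evolution t‖ ≤ ε)) ∧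
    -- gate count of one Trotter step
    (∀ Υ : ℕ, ∃ C : ℝ, 0 < C ∧
      ∀ (n : ℕ) (H : LocalHamiltonian n k) (F : ProductFormula Υ (n ^ k)) (s : ℝ),
        ∃ c : QCircuit n, c.toOp = H.trotterStep F s ∧ (c.length : ℝ) ≤ C * (n : ℝ) ^ k) ∧
    -- gate complexity, for every formula of sufficiently large order
    (∀ δ ε : ℝ, 0 < δ → 0 < ε → ∀ p Υ : ℕ, 1 ≤ p → 1 / (p : ℝ) ≤ δ → ∃ C : ℝ, 0 < C ∧
      ∀ (n : ℕ) (H : LocalHamiltonian n k) (F : ProductFormula Υ (n ^ k)),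
        F.IsOrder p H.generator → ∀ t : ℝ, 0 ≤ t →
          H.SimulatedWithGates F t ε
            (C * ((n : ℝ) ^ k * max 1 (H.inducedOneNorm * H.oneNorm ^ δ * t ^ (1 + δ))))) ∧
    -- gate complexity, with a suitable formula
    (∀ δ ε : ℝ, 0 < δ → 0 < ε → ∃ (p Υ : ℕ) (C : ℝ), 1 ≤ p ∧ 1 / (p : ℝ) ≤ δ ∧ 0 < C ∧
      ∀ n : ℕ, ∃ F : ProductFormula Υ (n ^ k), ∀ H : LocalHamiltonian n k,
        F.IsOrder p H.generator ∧ ∀ t : ℝ, 0 ≤ t →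
          H.SimulatedWithGates F t ε
            (C * ((n : ℝ) ^ k * max 1 (H.inducedOneNorm * H.oneNorm ^ δ * t ^ (1 + δ))))) := by
  refine ⟨fun p _ => ?_, fun p Υ hp => ?_, fun Υ => ?_, ?_, ?_⟩
  · refine ⟨LocalHamiltonian.commConst k p + 1,
      add_pos_of_nonneg_of_pos (LocalHamiltonian.commConst_nonneg k p) one_pos, fun n H => ?_⟩
    refine (H.alphaComm_le p).trans (mul_le_mul_of_nonneg_right (by linarith) ?_)
    exact mul_nonneg (pow_nonneg H.inducedOneNorm_nonneg p) H.oneNorm_nonneg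
  · obtain ⟨C, hC, herr⟩ := LocalHamiltonian.exists_trotter_error_bound k p Υ hp
    refine ⟨C, one_pos.trans_le hC, fun n H F hF => ⟨herr n H F hF, ?_⟩⟩
    intro t ε r ht hε hr hrC
    exact LocalHamiltonian.norm_trotterStep_pow_sub_evolution_le hp hC H F (herr n H F hF) ht hε hr
      hrC
  · obtain ⟨N, hN, hcirc⟩ := LocalHamiltonian.exists_hasCircuit_trotterStep k Υ
    refine ⟨N, by exact_mod_cast hN, fun n H F s => ?_⟩
    obtain ⟨c, hc, hlen⟩ := hcirc n H F s
    exact ⟨c, hc, by exact_mod_cast hlen⟩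
  · intro δ ε _ hε p Υ hp hδ
    exact LocalHamiltonian.exists_simulatedWithGates k p Υ hp hδ hε
  · intro δ ε hδ hε
    -- The Suzuki formula with index `κ` has its first error at `t ^ (2 * κ + 3)`, so its order `2 *
    -- κ + 2` exceeds `1 / δ`.
    obtain ⟨κ, hκ⟩ := exists_nat_gt (1 / δ)
    have hp : 1 ≤ 2 * κ + 2 := by omega
    have hpδ : 1 / ((2 * κ + 2 : ℕ) : ℝ) ≤ δ := by
      rw [one_div_le (by positivity) hδ]
      push_cast
      linarith [(Nat.cast_nonneg κ : (0 : ℝ) ≤ κ)]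
    obtain ⟨Υ, hΥ⟩ := ProductFormula.exists_suzuki_formula κ
    obtain ⟨C, hC, hsim⟩ := LocalHamiltonian.exists_simulatedWithGates k (2 * κ + 2) Υ hp hpδ hε
    refine ⟨2 * κ + 2, Υ, C, hp, hpδ, hC, fun n => ?_⟩
    obtain ⟨F, hF⟩ := hΥ (n ^ k)
    refine ⟨F, fun H => ?_⟩
    obtain ⟨-, w, hw⟩ := hF n H.generator
    have hord : F.IsOrder (2 * κ + 2) H.generator := ProductFormula.isOrder_of_flowApprox hw
    exact ⟨hord, hsim n H F hord⟩
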